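/- All graphs are finite, simple and undirected. For graph properties $\Pi_G$ and $\Pi$, let $P(G,\Pi_G,\Pi,k)$ denote the following decision problem: the input is a graph $G$ that has property $\Pi_G$, together with an integer $k\ge 0$; the question is whether $G$ has a set of exactly $k$ vertices that induces a subgraph with property $\Pi$. A graph is co-bipartite if its complement is bipartite. Let $\Pi'$ be one of the following four properties: being a forest, being planar, being bipartite, being triangle-free. Then both problems $P(G,\text{co-bipartite},\Pi',k)$ and $P(G,\Pi',\text{co-bipartite},k)$ are solvable in polynomial time, that is, by a deterministic Turing machine that answers every input correctly in a number of steps bounded by a polynomial in the length of the input ($G$ given by its adjacency matrix, $k$ in binary). -/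

import Mathlib

open Turing Computability

/-- A property of graphs. It is only ever applied to finite graphs. -/
abbrev GraphProperty : Type 1 := ∀ V : Type, SimpleGraph V → Prop

/-- The Euclidean plane. -/
abbrev Plane : Type := EuclideanSpace ℝ (Fin 2)

/-- A drawing without crossings of the graph `G` in the plane: distinct vertices are distinct
points, every edge is a simple arc (an injective continuous image of `[0, 1]`) that joins its two
ends and passes through no other vertex, and two distinct edges meet at most in a common end. -/
structure PlaneDrawing {V : Type*} (G : SimpleGraph V) where
  point : V → Plane
  arc : G.edgeSet → C(unitInterval, Plane)
  point_injective : Function.Injective point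
  arc_injective : ∀ e, Function.Injective (arc e)
  arc_ends : ∀ e : G.edgeSet, ∃ u v : V, (e : Sym2 V) = s(u, v) ∧ arc e 0 = point u ∧ arc e 1 = point v
  arc_vertex : ∀ (e : G.edgeSet) (v : V), point v ∈ Set.range (arc e) → v ∈ (e : Sym2 V)
  arc_inter : ∀ e e' : G.edgeSet, e ≠ e' → ∀ x, x ∈ Set.range (arc e) → x ∈ Set.range (arc e') →
    ∃ v : V, v ∈ (e : Sym2 V) ∧ v ∈ (e' : Sym2 V) ∧ x = point v

/-- The property of being planar. -/
def planar : GraphProperty := fun _ G => Nonempty (PlaneDrawing G)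

/-- The property of being a forest. -/
def forest : GraphProperty := fun _ G => G.IsAcyclic

/-- The property of being bipartite. -/
def bipartite : GraphProperty := fun _ G => G.IsBipartite

/-- The property of being triangle-free. -/
def triangleFree : GraphProperty := fun _ G => G.CliqueFree 3

/-- The property of being co-bipartite: the complement is bipartite. -/
def coBipartite : GraphProperty := fun _ G => Gᶜ.IsBipartite

namespace InducedSubgraphProblem

/-- An instance of the problem `P(G, PG, Q, k)`: a finite graph `G` that has the property `PG`,
together with a number `k`. -/
structure Instance (PG : GraphProperty) where
  n : ℕ
  graph : SimpleGraph (Fin n)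
  k : ℕ
  graph_mem : PG (Fin n) graph

/-- The answer to an instance: is there a set of exactly `k` vertices of `G` whose induced
subgraph has the property `Q`? -/
def IsYes {PG : GraphProperty} (Q : GraphProperty) (x : Instance PG) : Prop :=
  ∃ S : Finset (Fin x.n), S.card = x.k ∧ Q (S : Set (Fin x.n)) (x.graph.induce (S : Set (Fin x.n)))

open Classical in
/-- Row `i` of the adjacency matrix of a graph, followed by a comma. -/
noncomputable def encodeRow {n : ℕ} (G : SimpleGraph (Fin n)) (i : Fin n) : List Γ' :=
  (List.finRange n).map (fun j => Γ'.bit (decide (G.Adj i j))) ++ [Γ'.comma]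

/-- The input string of an instance: `k` in binary, a comma, and the rows of the adjacency matrix
of the graph, one after the other, each followed by a comma. -/
noncomputable def encodeInstance {PG : GraphProperty} (x : Instance PG) : List Γ' :=
  (encodeNat x.k).map Γ'.bit ++ Γ'.comma :: ((List.finRange x.n).map (encodeRow x.graph)).flatten

theorem length_encodeRow {n : ℕ} (G : SimpleGraph (Fin n)) (i : Fin n) :
    (encodeRow G i).length = n + 1 := by
  simp [encodeRow]

theorem encodeRow_injective {n : ℕ} {G H : SimpleGraph (Fin n)}
    (h : ∀ i, encodeRow G i = encodeRow H i) : G = H := by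
  ext i j
  have h1 := h i
  simp only [encodeRow, List.append_cancel_right_eq, List.map_inj_left, List.mem_finRange,
    forall_const, Γ'.bit.injEq, decide_eq_decide] at h1
  exact h1 j

theorem split_comma : ∀ (a b : List Bool) (u v : List Γ'),
    a.map Γ'.bit ++ Γ'.comma :: u = b.map Γ'.bit ++ Γ'.comma :: v → a = b ∧ u = v
  | [], [], u, v, h => by simpa using h
  | [], _ :: _, u, v, h => by simp at h
  | _ :: _, [], u, v, h => by simp at h
  | x :: a, y :: b, u, v, h => by
    simp only [List.map_cons, List.cons_append, List.cons.injEq, Γ'.bit.injEq] at h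
    obtain ⟨h1, h2⟩ := split_comma a b u v h.2
    exact ⟨by rw [h.1, h1], h2⟩

/-- Distinct instances have distinct input strings. -/
theorem encodeInstance_injective (PG : GraphProperty) :
    Function.Injective (encodeInstance (PG := PG)) := by
  rintro ⟨n, G, k, hG⟩ ⟨m, H, l, hH⟩ h
  obtain ⟨h1, h2⟩ := split_comma _ _ _ _ h
  have hk : k = l := by
    rw [← decode_encodeNat k, ← decode_encodeNat l]
    exact congrArg decodeNat h1
  have hlen := congrArg List.length h2
  simp only [List.length_flatten, List.map_map, Function.comp_def, length_encodeRow,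
    List.map_const', List.length_finRange, List.sum_replicate, smul_eq_mul] at hlen
  have hn : n = m := by nlinarith
  subst hn
  subst hk
  have h3 := List.eq_iff_flatten_eq.2 ⟨h2, by
    simp only [List.map_map, Function.comp_def, length_encodeRow]⟩
  have h4 : G = H := encodeRow_injective fun i => List.map_inj_left.1 h3 i (List.mem_finRange i)
  subst h4
  rfl

open Classical in
/-- `P(G, PG, Q, k)` is solvable in polynomial time: some multi-stack Turing machine answers every
instance correctly within a number of steps that is bounded by a polynomial, depending only on `PG`
and `Q`, in the length of the input string. -/
def SolvableInPolyTime (PG Q : GraphProperty) : Prop :=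
  Nonempty (TM2ComputableInPolyTime (encodeInstance (PG := PG)) encodeBool
    (fun x => decide (IsYes Q x)))

end InducedSubgraphProblem

/-! Each of the four properties passes to subgraphs and fails for the complete graph on five
vertices (`ExcludesFive`). A co-bipartite graph is covered by two cliques. If it has one of the four
properties, each clique has at most four vertices, so the graph has at most eight
(`ExcludesFive.card_le_eight`). In both problems the graph induced by a solution has both
properties: one by demand, the other because it is inherited from the input graph. Solutions
therefore have at most eight vertices, and trying all sets of `k ≤ 8` vertices is polynomial; for `k
> 8` the answer is no.

The only property for which excluding five vertices needs real work is planarity. If disjoint edges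
of a drawing never met, the difference of two disjoint edges would be a nowhere vanishing function
of two real parameters and would have a continuous logarithm. Following it around the unit square
gives one integer relation for each of the 15 pairs of disjoint edges. Their sum is impossible
modulo 4; this is the van Kampen obstruction, that is, the parity of the five crossings of a convex
pentagon with its diagonals.

The search is carried out by an actual machine. Structured stack programs are compiled to
multi-stack machines, and `solvableInPolyTime_of_card_le` is proved with a program whose unary
counters run through the increasing tuples of vertices. For each tuple the program copies the
adjacencies among its vertices to a finite table. Whether a table of this bounded size has the
property is a fixed function on the finite memory, hence part of the finite control, so no algorithm
for the property itself is needed. -/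

/-! ### Continuous logarithms and crossings of disjoint edges -/

/-- A continuous nowhere vanishing function on the plane has a continuous logarithm. -/
theorem exists_continuous_log (f : C(ℝ × ℝ, ℂ)) (hf : ∀ x, f x ≠ 0) :
    ∃ L : C(ℝ × ℝ, ℂ), ∀ x, Complex.exp (L x) = f x := by
  obtain ⟨L, ⟨-, hL⟩, -⟩ := Complex.isCoveringMapOn_exp.existsUnique_continuousMap_lifts f
    (a₀ := 0) (e₀ := Complex.log (f 0)) (Complex.exp_log (hf 0)) hf
  exact ⟨L, fun x => congrFun hL x⟩

/-- Two continuous logarithms of the same function differ by a constant. -/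
theorem log_sub_eq_of_exp_eq {f g : ℝ → ℂ} (hf : Continuous f) (hg : Continuous g)
    (h : ∀ t, Complex.exp (f t) = Complex.exp (g t)) (s t : ℝ) : f t - f s = g t - g s := by
  have h1 : Complex.exp (f s - g s) = 1 := by
    rw [Complex.exp_sub, h s, div_self (Complex.exp_ne_zero _)]
  have h2 := Complex.isCoveringMap_exp.eq_of_comp_eq (g₁ := f) (g₂ := fun t => g t + (f s - g s)) hf
    (by fun_prop) (by
      funext t
      simp only [Function.comp_apply, Subtype.mk.injEq]
      rw [Complex.exp_add, h1, mul_one, h t]) s (by ring)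
  have h3 := congrFun h2 t
  rw [h3]
  ring

/-- In every drawing of the complete graph on five vertices by curves in the plane, two disjoint
edges meet. -/
theorem exists_inter_of_five_points (p : Fin 5 → ℂ) (γ : Fin 5 → Fin 5 → C(ℝ, ℂ))
    (h0 : ∀ a b, a < b → γ a b 0 = p a) (h1 : ∀ a b, a < b → γ a b 1 = p b) :
    ∃ a b c d, a < b ∧ c < d ∧ a ≠ c ∧ a ≠ d ∧ b ≠ c ∧ b ≠ d ∧ ∃ s t, γ a b s = γ c d t := by
  by_contra! hd
  -- The points are distinct: if two coincided, two disjoint edges starting at them would meet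
  -- there.
  have hp : ∀ u v : Fin 5, u < v → p u - p v ≠ 0 := by
    intro u v huv h
    have aux : ∀ u v : Fin 5, u < v → ∃ x y, u ≠ x ∧ v ≠ y ∧ x ≠ v ∧ x ≠ y ∧ u ≠ y := by decide
    obtain ⟨x, y, hux, hvy, hxv, hxy, huy⟩ := aux u v huv
    have key : ∀ w z : Fin 5, w ≠ z →
        ∃ a b s, a < b ∧ γ a b s = p w ∧ ((a = w ∧ b = z) ∨ (a = z ∧ b = w)) := by
      intro w z hwz
      rcases lt_or_gt_of_ne hwz with h | h
      · exact ⟨w, z, 0, h, h0 _ _ h, .inl ⟨rfl, rfl⟩⟩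
      · exact ⟨z, w, 1, h, h1 _ _ h, .inr ⟨rfl, rfl⟩⟩
    obtain ⟨a, b, s, hab, hs, hab'⟩ := key u x hux
    obtain ⟨c, d, t, hcd, ht, hcd'⟩ := key v y hvy
    refine hd a b c d hab hcd ?_ ?_ ?_ ?_ s t (by rw [hs, ht]; exact sub_eq_zero.1 h) <;>
      rcases hab' with ⟨rfl, rfl⟩ | ⟨rfl, rfl⟩ <;> rcases hcd' with ⟨rfl, rfl⟩ | ⟨rfl, rfl⟩ <;>
      first | assumption | exact huv.ne
  -- Logarithms of the differences of points, chosen so that reversing the order of the two points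
  -- changes them by exactly `πi` up to the sign `σ`.
  let α : Fin 5 → Fin 5 → ℂ := fun u v =>
    if u < v then Complex.log (p u - p v) else Complex.log (p v - p u) + Real.pi * Complex.I
  have hα : ∀ u v, u ≠ v → Complex.exp (α u v) = p u - p v := by
    intro u v huv
    rcases lt_or_gt_of_ne huv with h | h
    · simp only [α, h, if_true]
      exact Complex.exp_log (hp u v h)
    · simp only [α, h.not_gt, if_false]
      rw [Complex.exp_add, Complex.exp_pi_mul_I, Complex.exp_log (hp v u h)]
      ring
  let σ : Fin 5 → Fin 5 → ℤ := fun u v => if u < v then -1 else 1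
  have hσ : ∀ u v, u ≠ v → α u v - α v u = (σ u v : ℂ) * (Real.pi * Complex.I) := by
    intro u v huv
    rcases lt_or_gt_of_ne huv with h | h
    · simp [α, σ, h, h.not_gt]
    · simp [α, σ, h, h.not_gt]
  -- `N v a b` measures how the edge `ab` winds around the point `v`, relative to the chosen
  -- logarithms at its ends. It does not depend on the logarithm `L`, since two of them differ by a
  -- constant. The value 0 in the remaining cases is a filler.
  have hN : ∀ v a b : Fin 5, ∃ N : ℤ, a < b → v ≠ a → v ≠ b → ∀ L : ℝ → ℂ, Continuous L →
      (∀ t, Complex.exp (L t) = γ a b t - p v) →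
      L 1 - L 0 = α b v - α a v + N * (2 * Real.pi * Complex.I) := by
    intro v a b
    by_cases hab : a < b ∧ v ≠ a ∧ v ≠ b
    · obtain ⟨hab, hva, hvb⟩ := hab
      by_cases hL : ∃ L : ℝ → ℂ, Continuous L ∧ ∀ t, Complex.exp (L t) = γ a b t - p v
      · obtain ⟨L, hLc, hL⟩ := hL
        have h2 : Complex.exp (L 1 - L 0) = Complex.exp (α b v - α a v) := by
          rw [Complex.exp_sub, Complex.exp_sub, hL, hL, hα b v hvb.symm, hα a v hva.symm,
            h0 a b hab, h1 a b hab]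
        obtain ⟨N, hN⟩ := Complex.exp_eq_exp_iff_exists_int.1 h2
        refine ⟨N, fun _ _ _ L' hL'c hL' => ?_⟩
        rw [← hN]
        exact log_sub_eq_of_exp_eq hL'c hLc (fun t => by rw [hL, hL']) 0 1
      · exact ⟨0, fun _ _ _ L hLc hL' => (hL ⟨L, hLc, hL'⟩).elim⟩
    · exact ⟨0, fun h h' h'' => (hab ⟨h, h', h''⟩).elim⟩
  choose N hN using hN
  -- A logarithm of `γ a b s - γ c d t` has total change zero around the unit square. On the sides
  -- `s = 0` and `s = 1` the difference has the opposite sign to the one in `hN`, which is why `πi`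
  -- is added there.
  have main : ∀ a b c d : Fin 5, a < b → c < d → a ≠ c → a ≠ d → b ≠ c → b ≠ d →
      σ b c - σ a c - σ b d + σ a d + 2 * (N c a b + N b c d - N d a b - N a c d) = 0 := by
    intro a b c d hab hcd hac had hbc hbd
    obtain ⟨L, hL⟩ := exists_continuous_log ⟨fun x => γ a b x.1 - γ c d x.2, by fun_prop⟩
      (fun x => sub_ne_zero.2 (hd a b c d hab hcd hac had hbc hbd x.1 x.2))
    simp only [ContinuousMap.coe_mk] at hL
    have e1 := hN c a b hab hac.symm hbc.symm (fun s => L (s, 0)) (by fun_prop)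
      (fun s => by rw [hL, h0 c d hcd])
    have e2 := hN d a b hab had.symm hbd.symm (fun s => L (s, 1)) (by fun_prop)
      (fun s => by rw [hL, h1 c d hcd])
    have e3 := hN a c d hcd hac had (fun t => L (0, t) + Real.pi * Complex.I) (by fun_prop)
      (fun s => by rw [Complex.exp_add, hL, h0 a b hab, Complex.exp_pi_mul_I]; ring)
    have e4 := hN b c d hcd hbc hbd (fun t => L (1, t) + Real.pi * Complex.I) (by fun_prop)
      (fun s => by rw [Complex.exp_add, hL, h1 a b hab, Complex.exp_pi_mul_I]; ring)
    have s1 := hσ b c hbc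
    have s2 := hσ a c hac
    have s3 := hσ b d hbd
    have s4 := hσ a d had
    have hpi : (Real.pi * Complex.I : ℂ) ≠ 0 := by simp [Real.pi_ne_zero]
    have : ((σ b c - σ a c - σ b d + σ a d + 2 * (N c a b + N b c d - N d a b - N a c d) : ℤ) : ℂ)
        = 0 := by
      apply (mul_eq_zero.1 (?_ : _ * (Real.pi * Complex.I : ℂ) = 0)).resolve_right hpi
      push_cast
      linear_combination -e1 - e4 + e2 + e3 - s1 + s2 + s3 - s4
    exact_mod_cast this
  have m1 := main 0 1 2 3 (by decide) (by decide) (by decide) (by decide) (by decide) (by decide)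
  have m2 := main 0 1 2 4 (by decide) (by decide) (by decide) (by decide) (by decide) (by decide)
  have m3 := main 0 1 3 4 (by decide) (by decide) (by decide) (by decide) (by decide) (by decide)
  have m4 := main 0 2 1 3 (by decide) (by decide) (by decide) (by decide) (by decide) (by decide)
  have m5 := main 0 2 1 4 (by decide) (by decide) (by decide) (by decide) (by decide) (by decide)
  have m6 := main 0 2 3 4 (by decide) (by decide) (by decide) (by decide) (by decide) (by decide)
  have m7 := main 0 3 1 2 (by decide) (by decide) (by decide) (by decide) (by decide) (by decide)
  have m8 := main 0 3 1 4 (by decide) (by decide) (by decide) (by decide) (by decide) (by decide)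
  have m9 := main 0 3 2 4 (by decide) (by decide) (by decide) (by decide) (by decide) (by decide)
  have m10 := main 0 4 1 2 (by decide) (by decide) (by decide) (by decide) (by decide) (by decide)
  have m11 := main 0 4 1 3 (by decide) (by decide) (by decide) (by decide) (by decide) (by decide)
  have m12 := main 0 4 2 3 (by decide) (by decide) (by decide) (by decide) (by decide) (by decide)
  have m13 := main 1 2 3 4 (by decide) (by decide) (by decide) (by decide) (by decide) (by decide)
  have m14 := main 1 3 2 4 (by decide) (by decide) (by decide) (by decide) (by decide) (by decide)
  have m15 := main 1 4 2 3 (by decide) (by decide) (by decide) (by decide) (by decide) (by decide)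
  simp [σ] at m1 m2 m3 m4 m5 m6 m7 m8 m9 m10 m11 m12 m13 m14 m15
  -- Add the 15 relations. Each `N v a b` occurs in exactly two of them, once for each choice of the
  -- other end of the edge at `v`, with coefficients `±2`, so these terms contribute a multiple of
  -- 4. The `σ` terms give 2 for each of the five interleaved pairs and 0 otherwise, in total 10,
  -- which is not divisible by 4.
  omega

/-! ### Drawings of subgraphs and the nonplanarity of the complete graph on five vertices -/

namespace PlaneDrawing

/-- The drawing of a graph that a drawing of a larger graph induces. -/
noncomputable def comap {V W : Type*} {G : SimpleGraph V} {H : SimpleGraph W} (D : PlaneDrawing H)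
    (f : G →g H) (hf : Function.Injective f) : PlaneDrawing G where
  point := D.point ∘ f
  arc e := D.arc (f.mapEdgeSet e)
  point_injective := D.point_injective.comp hf
  arc_injective e := D.arc_injective _
  arc_ends := by
    rintro ⟨e, he⟩
    induction e with
    | _ a b =>
      obtain ⟨u, v, h, h0, h1⟩ := D.arc_ends (f.mapEdgeSet ⟨s(a, b), he⟩)
      have h' : s(f a, f b) = s(u, v) := h
      rcases Sym2.eq_iff.1 h' with ⟨rfl, rfl⟩ | ⟨rfl, rfl⟩
      · exact ⟨a, b, rfl, h0, h1⟩
      · exact ⟨b, a, Sym2.eq_swap, h0, h1⟩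
  arc_vertex := by
    rintro ⟨e, he⟩ v hv
    obtain ⟨a, ha, hav⟩ := Sym2.mem_map.1 (D.arc_vertex _ _ hv)
    exact hf hav ▸ ha
  arc_inter := by
    rintro ⟨e, he⟩ ⟨e', he'⟩ hne x hx hx'
    obtain ⟨w, hw, hw', rfl⟩ := D.arc_inter _ _
      ((SimpleGraph.Hom.mapEdgeSet.injective f hf).ne hne) x hx hx'
    obtain ⟨a, ha, rfl⟩ := Sym2.mem_map.1 hw
    obtain ⟨b, hb, hba⟩ := Sym2.mem_map.1 hw'
    exact ⟨a, ha, hf hba ▸ hb, rfl⟩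

theorem exists_curve {V : Type*} {G : SimpleGraph V} (D : PlaneDrawing G) {a b : V}
    (h : G.Adj a b) : ∃ γ : C(unitInterval, Plane), γ 0 = D.point a ∧ γ 1 = D.point b ∧
      ∀ t, γ t ∈ Set.range (D.arc ⟨s(a, b), h⟩) := by
  obtain ⟨u, v, huv, h0, h1⟩ := D.arc_ends ⟨s(a, b), h⟩
  rcases Sym2.eq_iff.1 huv with ⟨rfl, rfl⟩ | ⟨rfl, rfl⟩
  · exact ⟨_, h0, h1, fun t => ⟨t, rfl⟩⟩
  · refine ⟨(D.arc ⟨s(a, b), h⟩).comp ⟨unitInterval.symm, by fun_prop⟩, ?_, ?_,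
      fun t => ⟨unitInterval.symm t, rfl⟩⟩
    · simpa using h1
    · simpa using h0

end PlaneDrawing

/-- The complete graph on five vertices is not planar. -/
theorem not_planar_completeGraph_five : ¬ planar (Fin 5) ⊤ := by
  rintro ⟨D⟩
  have H : ∀ a b : Fin 5, ∃ γ : C(unitInterval, Plane), ∀ h : a < b,
      γ 0 = D.point a ∧ γ 1 = D.point b ∧ ∀ t, γ t ∈ Set.range (D.arc ⟨s(a, b), h.ne⟩) := by
    intro a b
    by_cases h : a < b
    · obtain ⟨γ, hγ⟩ := D.exists_curve (a := a) (b := b) (G := ⊤) h.ne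
      exact ⟨γ, fun _ => hγ⟩
    · exact ⟨D.arc ⟨s(0, 1), by simp⟩, fun h' => (h h').elim⟩
  choose γ hγ using H
  let e : Plane ≃ₜ ℂ := Complex.orthonormalBasisOneI.repr.toHomeomorph.symm
  -- Extending the curves by constants outside `[0, 1]` adds no points, so it creates no new
  -- intersections.
  let γ' : Fin 5 → Fin 5 → C(ℝ, ℂ) := fun a b =>
    ⟨fun t => e (γ a b (Set.projIcc 0 1 zero_le_one t)),
      e.continuous.comp ((γ a b).continuous.comp continuous_projIcc)⟩
  obtain ⟨a, b, c, d, hab, hcd, hac, had, hbc, hbd, s, t, hst⟩ :=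
    exists_inter_of_five_points (fun v => e (D.point v)) γ'
      (fun a b h => by
        simp only [γ', ContinuousMap.coe_mk, Set.projIcc_left]
        exact congrArg e (hγ a b h).1)
      (fun a b h => by
        simp only [γ', ContinuousMap.coe_mk, Set.projIcc_right]
        exact congrArg e (hγ a b h).2.1)
  have hst' := e.injective hst
  have hne : (⟨s(a, b), hab.ne⟩ : (⊤ : SimpleGraph (Fin 5)).edgeSet) ≠ ⟨s(c, d), hcd.ne⟩ := by
    intro h
    rcases Sym2.eq_iff.1 (Subtype.ext_iff.1 h) with ⟨h, -⟩ | ⟨h, -⟩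
    · exact hac h
    · exact had h
  obtain ⟨v, hv, hv', -⟩ := D.arc_inter _ _ hne _ ((hγ a b hab).2.2 _)
    (hst' ▸ (hγ c d hcd).2.2 _)
  simp only [Sym2.mem_iff] at hv hv'
  rcases hv with rfl | rfl <;> rcases hv' with rfl | rfl <;> contradiction

/-! ### Monotone properties and the bound of eight vertices -/

namespace GraphProperty

/-- A property that passes to (not necessarily induced) subgraphs and excludes the complete graph
on five vertices. -/
structure ExcludesFive (Q : GraphProperty) : Prop where
  comap : ∀ {V W : Type} {G : SimpleGraph V} {H : SimpleGraph W} (f : G →g H),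
    Function.Injective f → Q W H → Q V G
  not_five : ¬ Q (Fin 5) ⊤

theorem excludesFive_planar : ExcludesFive planar where
  comap f hf := fun ⟨D⟩ => ⟨D.comap f hf⟩
  not_five := not_planar_completeGraph_five

theorem excludesFive_triangleFree : ExcludesFive triangleFree where
  comap f hf := fun h => SimpleGraph.CliqueFree.comap ⟨⟨f, hf⟩⟩ h
  not_five h := h {0, 1, 2} ⟨fun _ _ _ _ h => h, rfl⟩

theorem excludesFive_bipartite : ExcludesFive bipartite where
  comap f _ := fun h => SimpleGraph.Colorable.of_hom f h
  not_five h := SimpleGraph.Colorable.cliqueFree h (Nat.lt_succ_self 2) {0, 1, 2}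
    ⟨fun _ _ _ _ h => h, rfl⟩

theorem excludesFive_forest : ExcludesFive forest where
  comap f hf := fun h => SimpleGraph.IsAcyclic.comap f hf h
  not_five h := excludesFive_bipartite.not_five (SimpleGraph.IsAcyclic.isBipartite h)

/-- A property of graphs that isomorphic graphs share. -/
def IsoInvariant (Q : GraphProperty) : Prop :=
  ∀ {V W : Type} {G : SimpleGraph V} {H : SimpleGraph W}, G ≃g H → (Q V G ↔ Q W H)

theorem ExcludesFive.isoInvariant {Q : GraphProperty} (hQ : ExcludesFive Q) : IsoInvariant Q :=
  fun f => ⟨hQ.comap f.symm.toHom f.symm.injective, hQ.comap f.toHom f.injective⟩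

theorem isoInvariant_coBipartite : IsoInvariant coBipartite := by
  intro V W G H f
  let g : Gᶜ ≃g Hᶜ := ⟨f.toEquiv, by
    intro a b
    exact and_congr f.injective.ne_iff (not_congr f.map_adj_iff)⟩
  exact ⟨SimpleGraph.Colorable.of_hom g.symm.toHom, SimpleGraph.Colorable.of_hom g.toHom⟩

/-- A co-bipartite graph without five pairwise adjacent vertices has at most eight vertices. -/
theorem ExcludesFive.card_le_eight {Q : GraphProperty} (hQ : ExcludesFive Q) {V : Type} [Fintype V]
    {G : SimpleGraph V} (hG : Q V G) (hco : coBipartite V G) : Fintype.card V ≤ 8 := by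
  classical
  by_contra! hcard
  obtain ⟨C⟩ := hco
  -- More than `2 * 4` vertices in two colours leave five of one colour. They are independent in the
  -- complement, hence a clique in `G`.
  obtain ⟨i, hi⟩ := Fintype.exists_lt_card_fiber_of_mul_lt_card (f := C) (n := 4) (by simpa using hcard)
  obtain ⟨T, hT, hT5⟩ := Finset.exists_subset_card_eq (Nat.succ_le_of_lt hi)
  let e : Fin 5 ↪ V := (T.equivFinOfCardEq hT5).symm.toEmbedding.trans (Function.Embedding.subtype _)
  have he : ∀ j, C (e j) = i := fun j =>
    (Finset.mem_filter.1 (hT ((T.equivFinOfCardEq hT5).symm j).2)).2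
  let f : (⊤ : SimpleGraph (Fin 5)) →g G := ⟨e, by
    intro a b hab
    by_contra h
    exact C.valid (v := e a) (w := e b) ⟨e.injective.ne hab, h⟩ ((he a).trans (he b).symm)⟩
  exact hQ.not_five (hQ.comap f e.injective hG)

theorem ExcludesFive.induce {Q : GraphProperty} (hQ : ExcludesFive Q) {V : Type}
    {G : SimpleGraph V} (hG : Q V G) (S : Set V) : Q S (G.induce S) :=
  hQ.comap (SimpleGraph.Embedding.induce S).toHom Subtype.val_injective hG

theorem coBipartite_induce {V : Type} {G : SimpleGraph V} (hG : coBipartite V G) (S : Set V) :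
    coBipartite S (G.induce S) :=
  SimpleGraph.Colorable.of_hom (G := (G.induce S)ᶜ) (G' := Gᶜ)
    ⟨Subtype.val, fun h => ⟨Subtype.val_injective.ne h.1, h.2⟩⟩ hG

end GraphProperty

/-! ### Structured stack programs and their compilation -/

/-- Structured programs that act on stacks and on a finite memory. The program `drain k f c p` pops
the stack `k`, passes the symbol (if any) to the memory by means of `f`, and, as long as the test
`c` succeeds, runs `p` and repeats. -/
inductive StackProg (K A σ : Type) : Type
  | push (k : K) (f : σ → A) : StackProg K A σ
  | pop (k : K) (f : σ → Option A → σ) : StackProg K A σ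
  | load (f : σ → σ) : StackProg K A σ
  | seq (p q : StackProg K A σ) : StackProg K A σ
  | ite (c : σ → Bool) (p q : StackProg K A σ) : StackProg K A σ
  | drain (k : K) (f : σ → Option A → σ) (c : σ → Bool) (p : StackProg K A σ) : StackProg K A σ

namespace StackProg

variable {K A σ : Type}

/-- The labels of the instructions of a program. -/
def Label : StackProg K A σ → Type
  | push _ _ => Unit
  | pop _ _ => Unit
  | load _ => Unit
  | seq p q => Label p ⊕ Label q
  | ite _ p q => Option (Label p ⊕ Label q)
  | drain _ _ _ p => Option (Label p)

/-- The label of the first instruction. -/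
def entry : (p : StackProg K A σ) → Label p
  | push _ _ => ()
  | pop _ _ => ()
  | load _ => ()
  | seq p _ => Sum.inl (entry p)
  | ite _ _ _ => none
  | drain _ _ _ _ => none

theorem finite_label : (p : StackProg K A σ) → Finite (Label p)
  | push _ _ => inferInstanceAs (Finite Unit)
  | pop _ _ => inferInstanceAs (Finite Unit)
  | load _ => inferInstanceAs (Finite Unit)
  | seq p q =>
    have := finite_label p
    have := finite_label q
    inferInstanceAs (Finite (Label p ⊕ Label q))
  | ite _ p q =>
    have := finite_label p
    have := finite_label q
    inferInstanceAs (Finite (Option (Label p ⊕ Label q)))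
  | drain _ _ _ p =>
    have := finite_label p
    inferInstanceAs (Finite (Option (Label p)))

/-- The alphabets of the stacks of a machine: those that the program works on, and one for the
output. -/
def Alphabet (K A : Type) : Option K → Type
  | none => Bool
  | some _ => A

/-- All stacks of a machine. -/
def allStacks (S : K → List A) (o : List Bool) : ∀ k, List (Alphabet K A k)
  | none => o
  | some k => S k

theorem update_allStacks [DecidableEq K] (S : K → List A) (o : List Bool) (k : K) (l : List A) :
    Function.update (allStacks S o) (some k) l = allStacks (Function.update S k l) o := by
  funext k'
  cases k' with
  | none => rfl
  | some k' =>
    by_cases h : k' = k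
    · subst h
      simp only [allStacks, Function.update_self]
      exact Function.update_self ..
    · simp only [allStacks, Function.update_of_ne h]
      exact Function.update_of_ne (by simpa using h) ..

theorem stepAux_push [DecidableEq K] {Λ : Type} (k : K) (f : σ → A)
    (q : TM2.Stmt (Alphabet K A) Λ σ) (v : σ) (S : K → List A) (o : List Bool) :
    TM2.stepAux (.push (some k) f q) v (allStacks S o) =
      TM2.stepAux q v (allStacks (Function.update S k (f v :: S k)) o) := by
  rw [← update_allStacks]
  rfl

theorem stepAux_pop [DecidableEq K] {Λ : Type} (k : K) (f : σ → Option A → σ)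
    (q : TM2.Stmt (Alphabet K A) Λ σ) (v : σ) (S : K → List A) (o : List Bool) :
    TM2.stepAux (.pop (some k) f q) v (allStacks S o) =
      TM2.stepAux q (f v (S k).head?) (allStacks (Function.update S k (S k).tail) o) := by
  rw [← update_allStacks]
  rfl

/-- The machine code of a program whose labels are embedded by `e` in the labels of a machine and
that jumps to the label `x` when it ends. -/
def code {Λ : Type} : (p : StackProg K A σ) → (Label p → Λ) → Λ → Label p → TM2.Stmt (Alphabet K A) Λ σ
  | push k f, _, x, _ => .push (some k) f (.goto fun _ => x)
  | pop k f, _, x, _ => .pop (some k) f (.goto fun _ => x)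
  | load f, _, x, _ => .load f (.goto fun _ => x)
  | seq p q, e, _, Sum.inl l => code p (fun l => e (Sum.inl l)) (e (Sum.inr (entry q))) l
  | seq _ q, e, x, Sum.inr l => code q (fun l => e (Sum.inr l)) x l
  | ite c p q, e, _, none => .branch c (.goto fun _ => e (some (Sum.inl (entry p))))
      (.goto fun _ => e (some (Sum.inr (entry q))))
  | ite _ p _, e, x, some (Sum.inl l) => code p (fun l => e (some (Sum.inl l))) x l
  | ite _ _ q, e, x, some (Sum.inr l) => code q (fun l => e (some (Sum.inr l))) x l
  | drain k f c p, e, x, none => .pop (some k) f (.branch c (.goto fun _ => e (some (entry p)))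
      (.goto fun _ => x))
  | drain _ _ _ p, e, _, some l => code p (fun l => e (some l)) (e none) l

variable [DecidableEq K]

/-- The program `p` leads from the state `s` to the state `s'` in at most `b` steps. -/
def Runs (p : StackProg K A σ) (s s' : σ × (K → List A)) (b : ℕ) : Prop :=
  ∀ (Λ : Type) (M : Λ → TM2.Stmt (Alphabet K A) Λ σ) (e : Label p → Λ) (x : Λ),
    (∀ l, M (e l) = code p e x l) → ∃ t ≤ b,
      (flip bind (TM2.step M))^[t] (some ⟨some (e (entry p)), s.1, allStacks s.2 []⟩) =
        some ⟨some x, s'.1, allStacks s'.2 []⟩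

theorem Runs.mono {p : StackProg K A σ} {s s' : σ × (K → List A)} {b b' : ℕ}
    (h : Runs p s s' b) (hb : b ≤ b') : Runs p s s' b' := fun Λ M e x hM =>
  have ⟨t, ht, h⟩ := h Λ M e x hM
  ⟨t, ht.trans hb, h⟩

theorem runs_push (k : K) (f : σ → A) (v : σ) (S : K → List A) :
    Runs (push k f) (v, S) (v, Function.update S k (f v :: S k)) 1 := fun Λ M e x hM =>
  ⟨1, le_rfl, by
    have := hM (entry (push k f))
    simp only [code] at this
    simp only [flip, Function.iterate_one, Option.bind_eq_bind, Option.bind_some, TM2.step, this]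
    exact congrArg some (stepAux_push ..)⟩

theorem runs_pop (k : K) (f : σ → Option A → σ) (v : σ) (S : K → List A) :
    Runs (pop k f) (v, S) (f v (S k).head?, Function.update S k (S k).tail) 1 :=
  fun Λ M e x hM =>
  ⟨1, le_rfl, by
    have := hM (entry (pop k f))
    simp only [code] at this
    simp only [flip, Function.iterate_one, Option.bind_eq_bind, Option.bind_some, TM2.step, this]
    exact congrArg some (stepAux_pop ..)⟩

theorem runs_load (f : σ → σ) (v : σ) (S : K → List A) :
    Runs (load f) (v, S) (f v, S) 1 := fun Λ M e x hM =>
  ⟨1, le_rfl, by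
    have := hM (entry (load f))
    simp only [code] at this
    simp [flip, TM2.step, this]⟩

/-- `Runs` quantifies over every machine that contains the code and over every exit label. Both runs
therefore take place inside the machine of the composite, with the entry of `q` as the exit of `p`.
-/
theorem Runs.seq {p q : StackProg K A σ} {s₁ s₂ s₃ : σ × (K → List A)} {b b' : ℕ}
    (hp : Runs p s₁ s₂ b) (hq : Runs q s₂ s₃ b') : Runs (seq p q) s₁ s₃ (b + b') := by
  intro Λ M e x hM
  obtain ⟨t, ht, h⟩ := hp Λ M _ _ fun l => hM (Sum.inl l)
  obtain ⟨t', ht', h'⟩ := hq Λ M _ _ fun l => hM (Sum.inr l)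
  exact ⟨t' + t, by omega, by rw [Function.iterate_add_apply, entry, h, h']⟩

theorem Runs.ite_true {c : σ → Bool} {p q : StackProg K A σ} {s s' : σ × (K → List A)} {b : ℕ}
    (hc : c s.1 = true) (h : Runs p s s' b) : Runs (ite c p q) s s' (b + 1) := by
  intro Λ M e x hM
  obtain ⟨t, ht, h⟩ := h Λ M _ _ fun l => hM (some (Sum.inl l))
  refine ⟨t + 1, by omega, ?_⟩
  have := hM none
  simp only [code] at this
  rw [Function.iterate_succ_apply, ← h]
  simp [flip, TM2.step, entry, this, hc]

theorem Runs.ite_false {c : σ → Bool} {p q : StackProg K A σ} {s s' : σ × (K → List A)} {b : ℕ}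
    (hc : c s.1 = false) (h : Runs q s s' b) : Runs (ite c p q) s s' (b + 1) := by
  intro Λ M e x hM
  obtain ⟨t, ht, h⟩ := h Λ M _ _ fun l => hM (some (Sum.inr l))
  refine ⟨t + 1, by omega, ?_⟩
  have := hM none
  simp only [code] at this
  rw [Function.iterate_succ_apply, ← h]
  simp [flip, TM2.step, entry, this, hc]

theorem runs_drain_nil {k : K} {f : σ → Option A → σ} {c : σ → Bool} {p : StackProg K A σ}
    {v : σ} {S : K → List A} (hS : S k = []) (hc : c (f v none) = false) :
    Runs (drain k f c p) (v, S) (f v none, S) 1 := fun Λ M e x hM =>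
  ⟨1, le_rfl, by
    have := hM none
    simp only [code] at this
    have hS' : Function.update S k [] = S := by rw [← hS, Function.update_eq_self]
    simp only [flip, entry, Function.iterate_one, Option.bind_eq_bind, Option.bind_some, TM2.step,
      this]
    refine congrArg some ((stepAux_pop ..).trans ?_)
    simp [hS, hc, hS']⟩

/-- The body is compiled with the entry of the loop as its exit, so one pass of the body followed by
a run of the whole loop is again a run of the loop. With `runs_drain_nil` as base, this allows
induction on the number of passes. -/
theorem Runs.drain_cons {k : K} {f : σ → Option A → σ} {c : σ → Bool} {p : StackProg K A σ}
    {v : σ} {S : K → List A} {a : A} {l : List A} {s₁ s₂ : σ × (K → List A)}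
    {b b' : ℕ} (hS : S k = a :: l) (hc : c (f v (some a)) = true)
    (hp : Runs p (f v (some a), Function.update S k l) s₁ b)
    (hd : Runs (drain k f c p) s₁ s₂ b') : Runs (drain k f c p) (v, S) s₂ (b + b' + 1) := by
  intro Λ M e x hM
  obtain ⟨t, ht, h⟩ := hp Λ M _ _ fun l => hM (some l)
  obtain ⟨t', ht', h'⟩ := hd Λ M e x hM
  refine ⟨t' + (t + 1), by omega, ?_⟩
  have := hM none
  simp only [code] at this
  rw [Function.iterate_add_apply, Function.iterate_succ_apply, ← h', entry, ← h]
  congr 2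
  simp only [flip, Option.bind_eq_bind, Option.bind_some, TM2.step, this]
  refine congrArg some ((stepAux_pop ..).trans ?_)
  simp [hS, hc]

/-- The machine that executes a program and outputs the value of `f` at the final memory. -/
noncomputable def machine [Fintype K] [Fintype A] [Fintype σ] (k₀ : K) (init : σ) (f : σ → Bool)
    (p : StackProg K A σ) : FinTM2 :=
  haveI := finite_label p
  { K := Option K
    k₀ := some k₀
    k₁ := none
    Γ := Alphabet K A
    Λ := Option (Label p)
    main := some (entry p)
    ΛFin := Fintype.ofFinite _
    σ := σ
    initialState := init
    Γk₀Fin := inferInstanceAs (Fintype A)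
    m := fun l => l.elim (.push none f (.load (fun _ => init) .halt)) (code p some none) }

/-- A program that, started with the input on the stack `k₀`, ends with empty stacks, and within
polynomial time, yields a function computable in polynomial time. -/
theorem computableInPolyTime [Fintype K] [Fintype A] [Fintype σ] {α : Type} (ea : α → List A)
    (g : α → Bool) (k₀ : K) (init : σ) (f : σ → Bool) (p : StackProg K A σ) (time : Polynomial ℕ)
    (h : ∀ a, ∃ v, f v = g a ∧ Runs p (init, Function.update (fun _ => []) k₀ (ea a))
      (v, fun _ => []) (time.eval (ea a).length)) :
    Nonempty (TM2ComputableInPolyTime ea encodeBool g) := by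
  refine ⟨⟨⟨machine k₀ init f p, Equiv.refl A, Equiv.refl Bool⟩, time + 1, fun a => ?_⟩⟩
  apply Classical.choice
  obtain ⟨v, hv, h⟩ := h a
  obtain ⟨t, ht, h⟩ := h (Option (Label p)) (machine k₀ init f p).m some none fun _ => rfl
  -- The exit label pushes the answer, resets the memory and halts in a single machine step, which
  -- accounts for the extra 1. The reset is needed because `haltList` has the initial memory; it
  -- also has empty work stacks, so programs must clean up.
  have h' : (flip bind (machine k₀ init f p).step)^[1 + t]
      (some ⟨some (some (entry p)), init,
        allStacks (Function.update (fun _ => []) k₀ (ea a)) []⟩) =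
      some ⟨none, init, allStacks (fun _ => []) [g a]⟩ := by
    rw [Function.iterate_add_apply]
    refine (congrArg _ h).trans ?_
    rw [← hv]
    refine congrArg some (congrArg (TM2.Cfg.mk none init) ?_)
    funext k
    cases k <;> rfl
  have hinit : initList (machine k₀ init f p) (List.map (Equiv.refl A).invFun (ea a)) =
      ⟨some (some (entry p)), init, allStacks (Function.update (fun _ => []) k₀ (ea a)) []⟩ := by
    have hmap : List.map (Equiv.refl A).invFun (ea a) = ea a := List.map_id _
    refine (congrArg (initList (machine k₀ init f p)) hmap).trans ?_
    refine congrArg (TM2.Cfg.mk (some (some (entry p))) init) ?_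
    funext k
    cases k with
    | none => exact dif_neg (by rintro ⟨⟩)
    | some k =>
      by_cases hk : k = k₀
      · subst hk
        have e : Function.update (fun _ => []) k (ea a) k = ea a := Function.update_self ..
        exact (dif_pos rfl).trans e.symm
      · have e : Function.update (fun _ => []) k₀ (ea a) k = [] := Function.update_of_ne hk ..
        exact (dif_neg fun h => hk (Option.some.inj h)).trans e.symm
  have hhalt : haltList (machine k₀ init f p) (List.map (Equiv.refl Bool).invFun (encodeBool (g a))) =
      ⟨none, init, allStacks (fun _ => []) [g a]⟩ := by
    refine congrArg (TM2.Cfg.mk none init) ?_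
    funext k
    cases k with
    | none => exact dif_pos rfl
    | some k => exact dif_neg (by rintro ⟨⟩)
  have ht' : 1 + t ≤ (time + 1).eval (ea a).length := by
    rw [Polynomial.eval_add, Polynomial.eval_one]
    omega
  refine ⟨⟨⟨1 + t, ?_⟩, ht'⟩⟩
  exact (congrArg _ (congrArg some hinit)).trans (h'.trans (congrArg some hhalt.symm))

end StackProg

/-! ### Memory, stacks and counters of the search -/

namespace SubsetSearch

/-- The stacks of the search: the input, a stack that holds the part of the input left of the
reading head, a unary counter for the number of vertices, unary counters with an auxiliary counter
each. -/
inductive Tape (c : ℕ) : Type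
  | inp
  | back
  | num
  | ctr (i : Fin (c + 1))
  | aux (i : Fin (c + 1))
  deriving DecidableEq, Fintype

/-- The finite memory: the number of vertices that are wanted, the weight of the next binary digit
of it, whether that number has been read, a table of adjacencies, and the answer. -/
@[ext]
structure Mem (c : ℕ) : Type where
  cnt : Fin (c + 2)
  wt : Fin (c + 2)
  parsed : Bool
  tab : Fin (c + 1) → Fin (c + 1) → Bool
  ans : Bool
  deriving Fintype

variable {c : ℕ}

/-- Programs whose memory consists of a scratch cell for the symbol read last and a `Mem`. -/
abbrev Prog (c : ℕ) : Type := StackProg (Tape c) Γ' (Option Γ' × Mem c)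

/-- The contents of all stacks. -/
abbrev Stacks (c : ℕ) : Type := Tape c → List Γ'

/-- `p` leads from one state to another in at most `b` steps, whatever the scratch cell holds. -/
def Runs (p : Prog c) (s s' : Mem c × Stacks c) (b : ℕ) : Prop :=
  ∀ o, ∃ o', StackProg.Runs p ((o, s.1), s.2) ((o', s'.1), s'.2) b

theorem Runs.mono {p : Prog c} {s s' : Mem c × Stacks c} {b b' : ℕ} (h : Runs p s s' b)
    (hb : b ≤ b') : Runs p s s' b' := fun o => ⟨_, (h o).choose_spec.mono hb⟩

theorem Runs.seq {p q : Prog c} {s₁ s₂ s₃ : Mem c × Stacks c} {b b' : ℕ}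
    (hp : Runs p s₁ s₂ b) (hq : Runs q s₂ s₃ b') : Runs (.seq p q) s₁ s₃ (b + b') := fun o =>
  ⟨_, (hp o).choose_spec.seq (hq _).choose_spec⟩

/-- A counter, as a unary stack. -/
def unary (m : ℕ) : List Γ' := List.replicate m Γ'.blank

/-- The stacks with given contents. -/
def conf (l r : List Γ') (n : ℕ) (x y : Fin (c + 1) → ℕ) : Stacks c
  | .inp => l
  | .back => r
  | .num => unary n
  | .ctr i => unary (x i)
  | .aux i => unary (y i)

section update

variable (l r : List Γ') (n : ℕ) (x y : Fin (c + 1) → ℕ)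

theorem update_inp (l' : List Γ') :
    Function.update (conf l r n x y) .inp l' = conf l' r n x y := by
  funext k; cases k <;> simp [Function.update, conf]

theorem update_back (r' : List Γ') :
    Function.update (conf l r n x y) .back r' = conf l r' n x y := by
  funext k; cases k <;> simp [Function.update, conf]

theorem update_num (n' : ℕ) :
    Function.update (conf l r n x y) .num (unary n') = conf l r n' x y := by
  funext k; cases k <;> simp [Function.update, conf]

theorem update_ctr (i : Fin (c + 1)) (m : ℕ) :
    Function.update (conf l r n x y) (.ctr i) (unary m) =
      conf l r n (Function.update x i m) y := by
  funext k
  cases k with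
  | ctr j =>
    by_cases h : j = i
    · subst h; simp [conf]
    · simp [conf, h]
  | _ => simp [Function.update, conf]

theorem update_aux (i : Fin (c + 1)) (m : ℕ) :
    Function.update (conf l r n x y) (.aux i) (unary m) =
      conf l r n x (Function.update y i m) := by
  funext k
  cases k with
  | aux j =>
    by_cases h : j = i
    · subst h; simp [conf]
    · simp [conf, h]
  | _ => simp [Function.update, conf]

end update

theorem Runs.congr {p : Prog c} {s s' s'' : Mem c × Stacks c} {b b' : ℕ} (h : Runs p s s' b)
    (hs : s' = s'') (hb : b ≤ b') : Runs p s s'' b' := hs ▸ h.mono hb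

/-- Repeat `p` as long as the stack `k` can be popped, the symbol popped going to the scratch cell. -/
def drain (k : Tape c) (p : Prog c) : Prog c :=
  .drain k (fun v a => (a, v.2)) (fun v => v.1.isSome) p

/-- Do nothing. -/
def skip : Prog c := .load id

theorem runs_skip (s : Mem c × Stacks c) : Runs skip s s 1 := fun o =>
  ⟨o, StackProg.runs_load id (o, s.1) s.2⟩

theorem runs_load (f : Mem c → Mem c) (v : Mem c) (S : Stacks c) :
    Runs (.load fun w => (w.1, f w.2)) (v, S) (f v, S) 1 := fun o =>
  ⟨o, StackProg.runs_load _ _ _⟩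

theorem Runs.ite_true {t : Mem c → Bool} {p q : Prog c} {s s' : Mem c × Stacks c} {b : ℕ}
    (ht : t s.1 = true) (h : Runs p s s' b) : Runs (.ite (fun w => t w.2) p q) s s' (b + 1) :=
  fun o => ⟨_, StackProg.Runs.ite_true ht (h o).choose_spec⟩

theorem Runs.ite_false {t : Mem c → Bool} {p q : Prog c} {s s' : Mem c × Stacks c} {b : ℕ}
    (ht : t s.1 = false) (h : Runs q s s' b) : Runs (.ite (fun w => t w.2) p q) s s' (b + 1) :=
  fun o => ⟨_, StackProg.Runs.ite_false ht (h o).choose_spec⟩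

section steps

variable {l r : List Γ'} {n : ℕ} {x y : Fin (c + 1) → ℕ} {v : Mem c}

/-- Add one to a counter. -/
def incCtr (i : Fin (c + 1)) : Prog c := .push (.ctr i) fun _ => Γ'.blank

/-- Add one to an auxiliary counter. -/
def incAux (i : Fin (c + 1)) : Prog c := .push (.aux i) fun _ => Γ'.blank

theorem runs_incCtr (i : Fin (c + 1)) :
    Runs (incCtr i) (v, conf l r n x y)
      (v, conf l r n (Function.update x i (x i + 1)) y) 1 := fun o =>
  ⟨o, by
    rw [← update_ctr]
    exact StackProg.runs_push _ _ _ _⟩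

theorem runs_incAux (i : Fin (c + 1)) :
    Runs (incAux i) (v, conf l r n x y)
      (v, conf l r n x (Function.update y i (y i + 1))) 1 := fun o =>
  ⟨o, by
    rw [← update_aux]
    exact StackProg.runs_push _ _ _ _⟩

/-- Repeat `p` until the counter `i` is zero, each time after a decrement of it. -/
def loopCtr (i : Fin (c + 1)) (p : Prog c) : Prog c := drain (.ctr i) p

/-- Repeat `p` until the auxiliary counter `i` is zero, each time after a decrement of it. -/
def loopAux (i : Fin (c + 1)) (p : Prog c) : Prog c := drain (.aux i) p

/-- Repeat `p` until the counter of vertices is zero, each time after a decrement of it. -/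
def loopNum (p : Prog c) : Prog c := drain .num p

theorem runs_loopCtr_zero {i : Fin (c + 1)} {p : Prog c} (h : x i = 0) :
    Runs (loopCtr i p) (v, conf l r n x y) (v, conf l r n x y) 1 := fun o =>
  ⟨none, StackProg.runs_drain_nil (v := (o, v)) (by simp [conf, h, unary]) rfl⟩

theorem Runs.loopCtr_succ {i : Fin (c + 1)} {p : Prog c} {m : ℕ} {s₁ s₂ : Mem c × Stacks c}
    {b b' : ℕ} (h : x i = m + 1)
    (hp : Runs p (v, conf l r n (Function.update x i m) y) s₁ b)
    (hd : Runs (loopCtr i p) s₁ s₂ b') :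
    Runs (loopCtr i p) (v, conf l r n x y) s₂ (b + b' + 1) := by
  intro o
  obtain ⟨o₁, h₁⟩ := hp (some Γ'.blank)
  obtain ⟨o₂, h₂⟩ := hd o₁
  refine ⟨o₂, StackProg.Runs.drain_cons (v := (o, v)) (a := Γ'.blank) (l := unary m)
    (by simp [conf, h, unary, List.replicate_succ]) rfl ?_ h₂⟩
  rw [update_ctr]
  exact h₁

theorem runs_loopAux_zero {i : Fin (c + 1)} {p : Prog c} (h : y i = 0) :
    Runs (loopAux i p) (v, conf l r n x y) (v, conf l r n x y) 1 := fun o =>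
  ⟨none, StackProg.runs_drain_nil (v := (o, v)) (by simp [conf, h, unary]) rfl⟩

theorem Runs.loopAux_succ {i : Fin (c + 1)} {p : Prog c} {m : ℕ} {s₁ s₂ : Mem c × Stacks c}
    {b b' : ℕ} (h : y i = m + 1)
    (hp : Runs p (v, conf l r n x (Function.update y i m)) s₁ b)
    (hd : Runs (loopAux i p) s₁ s₂ b') :
    Runs (loopAux i p) (v, conf l r n x y) s₂ (b + b' + 1) := by
  intro o
  obtain ⟨o₁, h₁⟩ := hp (some Γ'.blank)
  obtain ⟨o₂, h₂⟩ := hd o₁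
  refine ⟨o₂, StackProg.Runs.drain_cons (v := (o, v)) (a := Γ'.blank) (l := unary m)
    (by simp [conf, h, unary, List.replicate_succ]) rfl ?_ h₂⟩
  rw [update_aux]
  exact h₁

theorem runs_loopNum_zero {p : Prog c} :
    Runs (loopNum p) (v, conf l r 0 x y) (v, conf l r 0 x y) 1 := fun o =>
  ⟨none, StackProg.runs_drain_nil (v := (o, v)) (by simp [conf, unary]) rfl⟩

theorem Runs.loopNum_succ {p : Prog c} {m : ℕ} {s₁ s₂ : Mem c × Stacks c} {b b' : ℕ}
    (hp : Runs p (v, conf l r m x y) s₁ b) (hd : Runs (loopNum p) s₁ s₂ b') :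
    Runs (loopNum p) (v, conf l r (m + 1) x y) s₂ (b + b' + 1) := by
  intro o
  obtain ⟨o₁, h₁⟩ := hp (some Γ'.blank)
  obtain ⟨o₂, h₂⟩ := hd o₁
  refine ⟨o₂, StackProg.Runs.drain_cons (v := (o, v)) (a := Γ'.blank) (l := unary m)
    (by simp [conf, unary, List.replicate_succ]) rfl ?_ h₂⟩
  rw [update_num]
  exact h₁

/-- Move the reading head to the right. -/
def right : Prog c :=
  .seq (.pop .inp fun v a => (a, v.2)) (.push .back fun v => v.1.getD Γ'.blank)

theorem runs_right (a : Γ') :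
    Runs right (v, conf (a :: l) r n x y) (v, conf l (a :: r) n x y) 2 := fun o =>
  ⟨some a, by
    refine StackProg.Runs.seq (b := 1) (b' := 1) (StackProg.runs_pop _ _ _ _) ?_
    have := StackProg.runs_push (Tape.back (c := c))
      (fun v : Option Γ' × Mem c => v.1.getD Γ'.blank) (some a, v) (conf l r n x y)
    rw [update_back] at this
    rw [show (conf (a :: l) r n x y Tape.inp).tail = l from rfl, update_inp]
    exact this⟩

/-- Move the reading head back to the beginning. -/
def rewind : Prog c := drain .back (.push .inp fun v => v.1.getD Γ'.blank)

theorem runs_rewind : Runs rewind (v, conf l r n x y)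
    (v, conf (r.reverse ++ l) [] n x y) (2 * r.length + 1) := by
  induction r generalizing l with
  | nil => exact fun o => ⟨none, StackProg.runs_drain_nil (v := (o, v)) rfl rfl⟩
  | cons a r ih =>
    intro o
    obtain ⟨o', h⟩ := ih (l := a :: l) (some a)
    rw [List.reverse_cons, List.append_assoc, List.singleton_append]
    refine ⟨o', (StackProg.Runs.drain_cons (k := Tape.back) (f := fun v a => (a, v.2))
      (c := fun v => v.1.isSome) (v := (o, v)) (a := a) (l := r) (b := 1) rfl rfl ?_ h).mono
      (by simp only [List.length_cons]; omega)⟩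
    have := StackProg.runs_push (Tape.inp (c := c))
      (fun v : Option Γ' × Mem c => v.1.getD Γ'.blank) (some a, v) (conf l r n x y)
    rw [update_inp] at this
    rw [update_back]
    exact this

/-- Set an entry of the table of adjacencies. -/
def Mem.set (v : Mem c) (i j : Fin (c + 1)) (b : Bool) : Mem c :=
  { v with tab := Function.update v.tab i (Function.update (v.tab i) j b) }

/-- Store in the table whether the symbol under the reading head is the bit `1`. -/
def readBit (i j : Fin (c + 1)) : Prog c :=
  .seq (.pop .inp fun v a => (a, v.2)) (.seq (.push .inp fun v => v.1.getD Γ'.blank)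
    (.load fun v => (v.1, v.2.set i j (decide (v.1 = some (Γ'.bit true))))))

theorem runs_readBit (i j : Fin (c + 1)) (a : Γ') :
    Runs (readBit i j) (v, conf (a :: l) r n x y)
      (v.set i j (decide (a = Γ'.bit true)), conf (a :: l) r n x y) 3 := fun o =>
  ⟨some a, by
    refine StackProg.Runs.seq (b := 1) (b' := 2) (StackProg.runs_pop _ _ _ _) ?_
    have h1 := StackProg.runs_push (Tape.inp (c := c))
      (fun v : Option Γ' × Mem c => v.1.getD Γ'.blank) (some a, v) (conf l r n x y)
    rw [update_inp] at h1
    rw [show (conf (a :: l) r n x y Tape.inp).tail = l from rfl, update_inp]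
    refine StackProg.Runs.seq (b := 1) (b' := 1) h1 ?_
    have h2 := StackProg.runs_load (fun v : Option Γ' × Mem c =>
        (v.1, v.2.set i j (decide (v.1 = some (Γ'.bit true))))) (some a, v) (conf (a :: l) r n x y)
    simp only [Option.some.injEq] at h2
    exact h2⟩

end steps

/-! ### Access to an entry of the adjacency matrix -/

/-- The stacks when the reading head is at position `p` of the word `W`. -/
def headAt (W : List Γ') (p : ℕ) (x y : Fin (c + 1) → ℕ) : Stacks c :=
  conf (W.drop p) (W.take p).reverse 0 x y

theorem update_of_eq {x : Fin (c + 1) → ℕ} {k : Fin (c + 1)} {m : ℕ} (h : x k = m) :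
    Function.update x k m = x := by
  rw [← h, Function.update_eq_self]

section walk

variable {W : List Γ'} {p : ℕ} {x y : Fin (c + 1) → ℕ} {v : Mem c}

theorem runs_right_headAt (h : p < W.length) :
    Runs right (v, headAt W p x y) (v, headAt W (p + 1) x y) 2 := by
  have := runs_right (l := W.drop (p + 1)) (r := (W.take p).reverse) (n := 0) (x := x) (y := y)
    (v := v) W[p]
  rwa [← List.drop_eq_getElem_cons h, ← List.reverse_concat, List.take_concat_get' W p h] at this

/-- Move the head to the right as often as the counter `k` says, and move this counter to its
auxiliary counter. -/
def walk (k : Fin (c + 1)) : Prog c := loopCtr k (.seq (incAux k) right)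

theorem runs_walk (k : Fin (c + 1)) (h : p + x k ≤ W.length) :
    Runs (walk k) (v, headAt W p x y)
      (v, headAt W (p + x k) (Function.update x k 0) (Function.update y k (y k + x k)))
      (4 * x k + 1) := by
  obtain ⟨m, hm⟩ : ∃ m, x k = m := ⟨_, rfl⟩
  induction m generalizing p x y with
  | zero =>
    refine (runs_loopCtr_zero hm).congr ?_ (by omega)
    simp [hm, update_of_eq hm, headAt]
  | succ m ih =>
    refine (Runs.loopCtr_succ hm ((runs_incAux k).seq
      (runs_right_headAt (W := W) (p := p) (by omega))) (ih ?_ ?_)).congr ?_ ?_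
    · simp only [Function.update_self]; omega
    · simp only [Function.update_self]
    · simp only [Function.update_self, Function.update_idem, hm]
      rw [Nat.add_right_comm p, Nat.add_right_comm (y k), Nat.add_assoc p, Nat.add_assoc (y k)]
    · simp only [Function.update_self]; omega

/-- Move the auxiliary counter `k` back to the counter `k`. -/
def restore (k : Fin (c + 1)) : Prog c := loopAux k (incCtr k)

theorem runs_restore {l r : List Γ'} {n : ℕ} (k : Fin (c + 1)) :
    Runs (restore k) (v, conf l r n x y)
      (v, conf l r n (Function.update x k (x k + y k)) (Function.update y k 0))
      (2 * y k + 1) := by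
  obtain ⟨m, hm⟩ : ∃ m, y k = m := ⟨_, rfl⟩
  induction m generalizing x y with
  | zero =>
    refine (runs_loopAux_zero hm).congr ?_ (by omega)
    simp [hm, update_of_eq hm]
  | succ m ih =>
    refine (Runs.loopAux_succ hm (runs_incCtr k) (ih ?_)).congr ?_ ?_
    · simp only [Function.update_self]
    · simp only [Function.update_self, Function.update_idem, hm]
      congr 3; ring_nf
    · simp only [Function.update_self]; omega

/-- Move the head one row down, where the counter `k` is the length of a row without its comma. -/
def nextRow (k : Fin (c + 1)) : Prog c := .seq (walk k) (.seq (restore k) right)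

theorem runs_nextRow (k : Fin (c + 1)) (hy : y k = 0) (h : p + (x k + 1) ≤ W.length) :
    Runs (nextRow k) (v, headAt W p x y) (v, headAt W (p + (x k + 1)) x y) (6 * x k + 4) := by
  refine ((runs_walk k (by omega)).seq ((runs_restore k).seq
    (runs_right_headAt (W := W) (p := p + x k) (by omega)))).congr ?_ ?_
  · simp [hy, add_assoc, update_of_eq hy]
  · simp [hy]; omega

/-- Move the head as many rows down as the counter `i` says, and move this counter to its
auxiliary counter. -/
def walkRows (k i : Fin (c + 1)) : Prog c := loopCtr i (.seq (incAux i) (nextRow k))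

theorem runs_walkRows {k i : Fin (c + 1)} (hik : i ≠ k) (hy : y k = 0)
    (h : p + x i * (x k + 1) ≤ W.length) :
    Runs (walkRows k i) (v, headAt W p x y)
      (v, headAt W (p + x i * (x k + 1)) (Function.update x i 0)
        (Function.update y i (y i + x i)))
      (x i * (6 * x k + 6) + 1) := by
  obtain ⟨m, hm⟩ : ∃ m, x i = m := ⟨_, rfl⟩
  induction m generalizing p x y with
  | zero =>
    refine (runs_loopCtr_zero hm).congr ?_ (by omega)
    simp [hm, update_of_eq hm, headAt]
  | succ m ih =>
    rw [hm] at h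
    have h' : p + (x k + 1) + m * (x k + 1) ≤ W.length := by linarith
    have hk : k ≠ i := hik.symm
    refine (Runs.loopCtr_succ hm ((runs_incAux i).seq
      (runs_nextRow (W := W) (p := p) k ?_ ?_)) (ih ?_ ?_ ?_)).congr ?_ ?_
    · simp [hk, hy]
    · simp only [Function.update_of_ne hk]
      exact (Nat.le_add_right _ _).trans h'
    · simp [hk, hy]
    · simpa only [Function.update_self, Function.update_of_ne hk] using h'
    · simp only [Function.update_self]
    · simp only [Function.update_self, Function.update_of_ne hk, Function.update_idem, hm]
      rw [show p + (x k + 1) + m * (x k + 1) = p + (m + 1) * (x k + 1) by ring,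
        show y i + 1 + m = y i + (m + 1) by ring]
    · simp only [Function.update_self, Function.update_of_ne hk, hm]
      apply le_of_eq
      ring

/-- Store in the table the entry of the adjacency matrix in the row and the column that the
counters `i` and `j` say. -/
def readAdj (k i j : Fin (c + 1)) : Prog c :=
  .seq (walkRows k i) (.seq (walk j) (.seq (readBit i j)
    (.seq (restore i) (.seq (restore j) rewind))))

/-- Counter `k` holds the row length without the comma, which explains the position. Walking empties
counters `i` and `j` into their auxiliary counters, from which they are restored. The row length
must survive while `i` is being emptied, hence `i ≠ k`. -/
theorem runs_readAdj {k i j : Fin (c + 1)} (hik : i ≠ k) (hij : i ≠ j) {a : Γ'}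
    (h : W[x i * (x k + 1) + x j]? = some a) :
    Runs (readAdj k i j) (v, headAt W 0 x 0)
      (v.set i j (decide (a = Γ'.bit true)), headAt W 0 x 0)
      (6 * (x i * (x k + 1)) + 2 * x i + 6 * x j + 2 * W.length + 8) := by
  obtain ⟨hlt, ha⟩ := List.getElem?_eq_some_iff.1 h
  let q := x i * (x k + 1)
  let x₁ := Function.update x i 0
  let y₁ : Fin (c + 1) → ℕ := Function.update 0 i (x i)
  let x₂ := Function.update x₁ j 0
  let y₂ := Function.update y₁ j (x j)
  have h₁ : Runs (walkRows k i) (v, headAt W 0 x 0) (v, headAt W q x₁ y₁)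
      (x i * (6 * x k + 6) + 1) :=
    (runs_walkRows (p := 0) (x := x) (y := 0) hik rfl (by omega)).congr
      (by simp [q, x₁, y₁]) le_rfl
  have h₂ : Runs (walk j) (v, headAt W q x₁ y₁) (v, headAt W (q + x j) x₂ y₂) (4 * x j + 1) := by
    have hx : x₁ j = x j := Function.update_of_ne hij.symm ..
    have hy : y₁ j = 0 := Function.update_of_ne hij.symm ..
    have := runs_walk (v := v) (W := W) (p := q) (x := x₁) (y := y₁) j (by omega)
    rwa [hx, hy, Nat.zero_add] at this
  have h₃ : Runs (readBit i j) (v, headAt W (q + x j) x₂ y₂)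
      (v.set i j (decide (a = Γ'.bit true)), headAt W (q + x j) x₂ y₂) 3 := by
    have := runs_readBit (v := v) (l := W.drop (q + x j + 1)) (r := (W.take (q + x j)).reverse)
      (n := 0) (x := x₂) (y := y₂) i j a
    rwa [← ha, ← List.drop_eq_getElem_cons hlt, ha] at this
  refine (h₁.seq (h₂.seq (h₃.seq ((runs_restore i).seq ((runs_restore j).seq
    runs_rewind))))).congr ?_ ?_
  · refine Prod.ext rfl ?_
    simp only [headAt, List.reverse_reverse, List.take_append_drop, List.drop_zero, List.take_zero,
      List.reverse_nil]
    congr 1 <;> funext m <;> by_cases h1 : m = i <;> by_cases h2 : m = j <;>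
      simp_all [Function.update_apply, x₁, x₂, y₁, y₂]
  · have e₁ : y₂ i = x i := by simp [y₂, y₁, hij]
    have e₂ : Function.update y₂ i 0 j = x j := by simp [y₂, hij.symm]
    rw [e₁, e₂, List.length_reverse, List.length_take]
    have : x i * (6 * x k + 6) = 6 * (x i * (x k + 1)) := by ring
    omega

end walk

/-! ### Enumeration of the vertex sets -/

section search

variable {W : List Γ'} {n : ℕ} {A : ℕ → ℕ → Bool} {x : Fin (c + 1) → ℕ} {v : Mem c}

/-- Store in the table the entries of the adjacency matrix that belong to the pairs in a list. -/
def readAll (k : Fin (c + 1)) : List (Fin (c + 1) × Fin (c + 1)) → Prog c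
  | [] => skip
  | e :: l => .seq (readAdj k e.1 e.2) (readAll k l)

/-- A bound for the number of steps that it takes to read an entry of a matrix with `n` rows from
an input of length `w`. -/
def readTime (w n : ℕ) : ℕ := 6 * (n * (n + 1)) + 8 * n + 2 * w + 8

theorem runs_readAll {k : Fin (c + 1)} (hk : x k = n)
    (hW : ∀ a b, a < n → b < n → W[a * (n + 1) + b]? = some (Γ'.bit (A a b)))
    (l : List (Fin (c + 1) × Fin (c + 1)))
    (hl : ∀ e ∈ l, e.1 ≠ k ∧ e.1 ≠ e.2 ∧ x e.1 < n ∧ x e.2 < n) :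
    ∃ v' : Mem c, Runs (readAll k l) (v, headAt W 0 x 0) (v', headAt W 0 x 0)
        (l.length * readTime W.length n + 1) ∧ v'.ans = v.ans ∧
      ∀ i j, v'.tab i j = if (i, j) ∈ l then A (x i) (x j) else v.tab i j := by
  induction l generalizing v with
  | nil => exact ⟨v, (runs_skip _).mono (by omega), rfl, by simp⟩
  | cons e l ih =>
    obtain ⟨h1, h2, h3, h4⟩ := hl e List.mem_cons_self
    have ha := hW _ _ h3 h4
    rw [← hk] at ha
    obtain ⟨v', hv, hans, htab⟩ := ih (v := v.set e.1 e.2 (decide (Γ'.bit (A (x e.1) (x e.2)) =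
      Γ'.bit true))) (fun e' he' => hl e' (List.mem_cons_of_mem _ he'))
    refine ⟨v', ((runs_readAdj h1 h2 ha).seq hv).mono ?_, hans, fun i j => ?_⟩
    · have h5 : x e.1 * (x k + 1) ≤ n * (n + 1) := by
        rw [hk]
        exact Nat.mul_le_mul_right _ h3.le
      rw [List.length_cons, Nat.add_one_mul l.length]
      unfold readTime
      omega
    · rw [htab]
      by_cases hm : (i, j) ∈ l
      · simp [hm]
      · by_cases he : (i, j) = e
        · subst he
          simp [Mem.set]
        · rw [if_neg hm, if_neg (by simp [he, hm])]
          by_cases hi : i = e.1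
          · have hj : j ≠ e.2 := fun hj => he (Prod.ext hi hj)
            simp [Mem.set, hi, hj]
          · simp [Mem.set, hi]

/-- The pairs of increasing indices below `k`. -/
noncomputable def pairsBelow (k : Fin (c + 1)) : List (Fin (c + 1) × Fin (c + 1)) :=
  (Finset.univ.filter fun e : Fin (c + 1) × Fin (c + 1) => e.1 < e.2 ∧ e.2 < k).toList

theorem mem_pairsBelow {k : Fin (c + 1)} {e : Fin (c + 1) × Fin (c + 1)} :
    e ∈ pairsBelow k ↔ e.1 < e.2 ∧ e.2 < k := by
  simp [pairsBelow]

/-- The graph on the indices below `k` with a given table of adjacencies. -/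
def patternGraph (k : Fin (c + 1)) (t : Fin (c + 1) → Fin (c + 1) → Bool) :
    SimpleGraph {i : Fin (c + 1) // i < k} :=
  SimpleGraph.fromRel fun i j => i < j ∧ t i j = true

/-- Only entries above the diagonal matter, so it suffices to read the pairs in `pairsBelow k`. -/
theorem patternGraph_congr {k : Fin (c + 1)} {t t' : Fin (c + 1) → Fin (c + 1) → Bool}
    (h : ∀ i j, i < j → j < k → t i j = t' i j) : patternGraph k t = patternGraph k t' := by
  ext i j
  simp only [patternGraph, SimpleGraph.fromRel_adj]
  have h1 : i < j → t i j = t' i j := fun hij => h i j hij j.2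
  have h2 : j < i → t j i = t' j i := fun hij => h j i hij i.2
  constructor <;> rintro ⟨hne, ⟨hlt, ht⟩ | ⟨hlt, ht⟩⟩ <;> simp_all

open Classical in
/-- Note whether the graph with the given table of adjacencies has the property `Q`. -/
noncomputable def Mem.note (Q : GraphProperty) (k : Fin (c + 1)) (v : Mem c) : Mem c :=
  { v with ans := v.ans || decide (Q _ (patternGraph k v.tab)) }

/-- Read the adjacencies between the vertices that the counters below `k` hold, and note whether
the graph that they induce has the property `Q`. -/
noncomputable def evaluate (Q : GraphProperty) (k : Fin (c + 1)) : Prog c :=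
  .seq (readAll k (pairsBelow k)) (.load fun w => (w.1, w.2.note Q k))

/-- Set the counter `b`, which is zero, to the value of the counter `a`. -/
def copyCtr (a b : Fin (c + 1)) : Prog c :=
  .seq (loopCtr a (.seq (incAux a) (incCtr b))) (restore a)

theorem runs_copyCtr {l r : List Γ'} {m : ℕ} {a b : Fin (c + 1)} (hab : a ≠ b) (hb : x b = 0) :
    Runs (copyCtr a b) (v, conf l r m x 0) (v, conf l r m (Function.update x b (x a)) 0)
      (5 * x a + 2) := by
  have key : ∀ (t : ℕ) (x y : Fin (c + 1) → ℕ), x a = t →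
      Runs (loopCtr a (.seq (incAux a) (incCtr b))) (v, conf l r m x y)
        (v, conf l r m (Function.update (Function.update x a 0) b (x b + t))
          (Function.update y a (y a + t))) (3 * t + 1) := by
    intro t
    induction t with
    | zero =>
      intro x y hx
      refine (runs_loopCtr_zero hx).congr ?_ (by omega)
      simp [update_of_eq hx]
    | succ t ih =>
      intro x y hx
      refine (Runs.loopCtr_succ hx ((runs_incAux a).seq (runs_incCtr b)) (ih _ _ ?_)).congr ?_ ?_
      · simp [hab]
      · refine Prod.ext rfl ?_
        simp only [Function.update_self, Function.update_idem]
        congr 1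
        · funext j
          simp only [Function.update_apply]
          split_ifs <;> simp_all; omega
        · congr 1; omega
      · omega
  refine ((key (x a) x 0 rfl).seq (runs_restore a)).congr ?_ ?_
  · refine Prod.ext rfl ?_
    dsimp only
    congr 1 <;> funext j <;> by_cases h1 : j = a <;> by_cases h2 : j = b <;>
      simp_all
  · simp; omega

/-- The index `i` of a counter. -/
def idx (c i : ℕ) : Fin (c + 1) := Fin.ofNat (c + 1) i

theorem val_idx {i : ℕ} (h : i ≤ c) : (idx c i).val = i := Nat.mod_eq_of_lt (Nat.lt_succ_of_le h)

theorem idx_val (i : Fin (c + 1)) : idx c i.val = i :=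
  Fin.ext (val_idx (Nat.le_of_lt_succ i.2))

/-- Run through all decreasing values of the counters below `i` and evaluate each choice. -/
noncomputable def search (Q : GraphProperty) (k : Fin (c + 1)) : ℕ → Prog c
  | 0 => evaluate Q k
  | i + 1 => .seq (copyCtr (idx c (i + 1)) (idx c i)) (loopCtr (idx c i) (search Q k i))

/-- A bound for the number of steps of the search. -/
noncomputable def searchTime (k : Fin (c + 1)) (w n : ℕ) : ℕ → ℕ
  | 0 => (pairsBelow k).length * readTime w n + 2
  | i + 1 => 5 * n + 2 + (n * (searchTime k w n i + 1) + 1)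

theorem lt_of_forall_lt_succ {i k : ℕ} (hx : ∀ j, i ≤ j → j < k → x (idx c j) < x (idx c (j + 1)))
    {j : ℕ} (hij : i ≤ j) (hjk : j < k) : x (idx c j) < x (idx c k) := by
  suffices h : ∀ m, j + 1 ≤ m → m ≤ k → x (idx c j) < x (idx c m) from h k hjk le_rfl
  intro m hjm
  induction m, hjm using Nat.le_induction with
  | base => exact fun _ => hx j hij hjk
  | succ m hm ih => exact fun hmk => (ih (by omega)).trans (hx m (by omega) (by omega))

/-- Counter `k` holds the sentinel `n`, the counters from `i` to `k` are strictly increasing, and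
those below `i` are still zero. The search tries all increasing ways to fill in the latter,
accumulates the disjunction of the results in `ans`, and leaves the counters as it found them.
Induction on `i` adds one nested loop at a time. -/
theorem runs_search (Q : GraphProperty) {k : Fin (c + 1)}
    (hW : ∀ a b, a < n → b < n → W[a * (n + 1) + b]? = some (Γ'.bit (A a b)))
    (i : ℕ) (hi : i ≤ k) (x : Fin (c + 1) → ℕ) (hk : x k = n)
    (h0 : ∀ j : Fin (c + 1), j.val < i → x j = 0)
    (hx : ∀ j, i ≤ j → j < k → x (idx c j) < x (idx c (j + 1))) (v : Mem c) :
    ∃ v' : Mem c, Runs (search Q k i) (v, headAt W 0 x 0) (v', headAt W 0 x 0)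
        (searchTime k W.length n i) ∧
      (v'.ans = true ↔ v.ans = true ∨ ∃ z : Fin (c + 1) → ℕ,
        (∀ j : Fin (c + 1), i ≤ j → z j = x j) ∧ (∀ j < i, z (idx c j) < z (idx c (j + 1))) ∧
        Q _ (patternGraph k fun a b => A (z a) (z b))) := by
  have hkc : k.val ≤ c := Nat.le_of_lt_succ k.2
  induction i generalizing x v with
  | zero =>
    have hn : ∀ j : Fin (c + 1), j < k → x j < n := by
      intro j hj
      have := lt_of_forall_lt_succ hx (Nat.zero_le _) hj
      rwa [idx_val, idx_val, hk] at this
    obtain ⟨v', hv, hans, htab⟩ := runs_readAll (v := v) hk hW (pairsBelow k) (by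
      rintro ⟨a, b⟩ he
      obtain ⟨h1, h2⟩ := mem_pairsBelow.1 he
      exact ⟨(h1.trans h2).ne, h1.ne, hn a (h1.trans h2), hn b h2⟩)
    refine ⟨_, (hv.seq (runs_load (fun w => w.note Q k) _ _)).mono le_rfl, ?_⟩
    have e : patternGraph k v'.tab = patternGraph k fun a b => A (x a) (x b) :=
      patternGraph_congr fun a b hab hb => by rw [htab, if_pos (mem_pairsBelow.2 ⟨hab, hb⟩)]
    simp [Mem.note, hans, e, ← funext_iff]
  | succ i ih =>
    have vi : (idx c i).val = i := val_idx (by omega)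
    have vi1 : (idx c (i + 1)).val = i + 1 := val_idx (by omega)
    have hne : idx c (i + 1) ≠ idx c i := fun h => by
      have := congrArg Fin.val h
      omega
    have hle : x (idx c (i + 1)) ≤ n := by
      rcases Nat.lt_or_ge (i + 1) k with h | h
      · have := lt_of_forall_lt_succ hx le_rfl h
        rw [idx_val, hk] at this
        exact this.le
      · have : idx c (i + 1) = k := Fin.ext (by omega)
        rw [this, hk]
    -- The counter is decremented before each pass, so a loop that starts at `m` tries the values `m
    -- - 1` down to 0. Starting at the value of the next counter thus gives exactly the smaller
    -- values.
    have loop : ∀ m ≤ x (idx c (i + 1)), ∀ v : Mem c, ∃ v' : Mem c,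
        Runs (loopCtr (idx c i) (search Q k i))
          (v, headAt W 0 (Function.update x (idx c i) m) 0) (v', headAt W 0 x 0)
          (m * (searchTime k W.length n i + 1) + 1) ∧
        (v'.ans = true ↔ v.ans = true ∨ ∃ r < m, ∃ z : Fin (c + 1) → ℕ,
          (∀ j : Fin (c + 1), i ≤ j → z j = Function.update x (idx c i) r j) ∧
          (∀ j < i, z (idx c j) < z (idx c (j + 1))) ∧
          Q _ (patternGraph k fun a b => A (z a) (z b))) := by
      intro m
      induction m with
      | zero =>
        intro _ v
        rw [update_of_eq (h0 _ (by omega))]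
        exact ⟨v, (runs_loopCtr_zero (h0 _ (by omega))).mono (by omega), by simp⟩
      | succ m ihm =>
        intro hm v
        have hx' : ∀ j, i ≤ j → j < k → Function.update x (idx c i) m (idx c j) <
            Function.update x (idx c i) m (idx c (j + 1)) := by
          intro j hij hjk
          have hj1 : idx c (j + 1) ≠ idx c i := fun h => by
            have := congrArg Fin.val h
            rw [val_idx (by omega), vi] at this
            omega
          rw [Function.update_of_ne hj1]
          rcases Nat.eq_or_lt_of_le hij with rfl | h
          · rw [Function.update_self]
            omega
          · rw [Function.update_of_ne (fun h' => by
              have := congrArg Fin.val h'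
              rw [val_idx (by omega), vi] at this
              omega)]
            exact hx j h hjk
        obtain ⟨v₁, hv₁, hans₁⟩ := ih (by omega) (Function.update x (idx c i) m)
          (by rw [Function.update_of_ne (fun h => by
                have := congrArg Fin.val h
                omega), hk])
          (fun j hj => by
            rw [Function.update_of_ne (fun h => by
              have := congrArg Fin.val h
              omega)]
            exact h0 j (by omega))
          hx' v
        obtain ⟨v₂, hv₂, hans₂⟩ := ihm (by omega) v₁
        refine ⟨v₂, (Runs.loopCtr_succ (b := searchTime k W.length n i)
          (Function.update_self ..) ?_ hv₂).mono ?_, ?_⟩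
        · rw [Function.update_idem]
          exact hv₁
        · rw [Nat.add_one_mul m]
          omega
        · rw [hans₂, hans₁, or_assoc]
          refine or_congr_right ⟨?_, ?_⟩
          · rintro (h | ⟨r, hr, h⟩)
            · exact ⟨m, Nat.lt_succ_self m, h⟩
            · exact ⟨r, Nat.lt_succ_of_lt hr, h⟩
          · rintro ⟨r, hr, h⟩
            rcases Nat.eq_or_lt_of_le (Nat.le_of_lt_succ hr) with rfl | hr
            · exact Or.inl h
            · exact Or.inr ⟨r, hr, h⟩
    obtain ⟨v', hv', hans⟩ := loop _ le_rfl v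
    refine ⟨v', ((runs_copyCtr hne (h0 _ (by omega))).seq hv').mono ?_, ?_⟩
    · have := Nat.mul_le_mul_right (searchTime k W.length n i + 1) hle
      simp only [searchTime]
      omega
    · rw [hans]
      refine or_congr_right ⟨?_, ?_⟩
      · rintro ⟨r, hr, z, hz, hz', hQ⟩
        refine ⟨z, fun j hj => ?_, fun j hj => ?_, hQ⟩
        · rw [hz j (by omega), Function.update_of_ne (fun h => by
            have := congrArg Fin.val h
            omega)]
        · rcases Nat.eq_or_lt_of_le (Nat.le_of_lt_succ hj) with rfl | hj
          · rwa [hz _ (by omega), hz _ (by omega), Function.update_self, Function.update_of_ne hne]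
          · exact hz' j hj
      · rintro ⟨z, hz, hz', hQ⟩
        refine ⟨z (idx c i), ?_, z, fun j hj => ?_, fun j hj => hz' j (by omega), hQ⟩
        · rw [← hz _ (by omega)]
          exact hz' i (Nat.lt_succ_self i)
        · by_cases hji : j = idx c i
          · rw [hji, Function.update_self]
          · rw [Function.update_of_ne hji, hz j]
            have : j.val ≠ i := fun h => hji (Fin.ext (h.trans vi.symm))
            omega

end search

/-! ### Reading the input -/

section parse

variable {l r : List Γ'} {n : ℕ} {x y : Fin (c + 1) → ℕ} {v : Mem c}

/-- The number `m`, or `c + 1` if `m` is larger than that. -/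
def cap (c m : ℕ) : Fin (c + 2) := ⟨min m (c + 1), by omega⟩

/-- The number with given binary digits, the least significant one first. -/
def ofBits : List Bool → ℕ
  | [] => 0
  | b :: l => b.toNat + 2 * ofBits l

theorem ofBits_encodePosNum (m : PosNum) : ofBits (encodePosNum m) = m := by
  induction m with
  | one => rfl
  | bit0 m ih => simp [encodePosNum, ofBits, ih, PosNum.cast_bit0]; ring
  | bit1 m ih => simp [encodePosNum, ofBits, ih, PosNum.cast_bit1]; ring

theorem ofBits_encodeNat (m : ℕ) : ofBits (encodeNat m) = m := by
  conv_rhs => rw [← Num.to_of_nat m]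
  unfold encodeNat
  cases (m : Num) with
  | zero => rfl
  | pos m => simpa [encodeNum] using ofBits_encodePosNum m

/-- Process a symbol of the part of the input that ends with the first comma. -/
def Mem.digit (v : Mem c) : Option Γ' → Mem c
  | some (Γ'.bit b) => { v with
      cnt := cap c (v.cnt + b.toNat * v.wt)
      wt := cap c (2 * v.wt) }
  | some Γ'.comma => { v with parsed := true }
  | _ => v

/-- Process a symbol of the input. -/
def parseSymbol : Prog c :=
  .ite (fun w => w.2.parsed)
    (.seq (.push .back fun w => w.1.getD Γ'.blank)
      (.ite (fun w => decide (w.1 = some Γ'.comma)) (.push .num fun _ => Γ'.blank) skip))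
    (.load fun w => (w.1, w.2.digit w.1))

theorem runs_parseSymbol_of_parsed (h : v.parsed = true) (a : Γ') :
    StackProg.Runs parseSymbol ((some a, v), conf l r n x y)
      ((some a, v), conf l (a :: r) (n + if a = Γ'.comma then 1 else 0) x y) 4 := by
  have h₁ := StackProg.runs_push (Tape.back (c := c))
    (fun v : Option Γ' × Mem c => v.1.getD Γ'.blank) (some a, v) (conf l r n x y)
  rw [update_back] at h₁
  refine StackProg.Runs.ite_true (b := 3) h (StackProg.Runs.seq (b := 1) (b' := 2) h₁ ?_)
  by_cases ha : a = Γ'.comma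
  · have h₂ := StackProg.runs_push (Tape.num (c := c))
      (fun _ : Option Γ' × Mem c => Γ'.blank) (some a, v) (conf l (a :: r) n x y)
    rw [show Γ'.blank :: conf l (a :: r) n x y Tape.num = unary (n + 1) from rfl,
      update_num] at h₂
    rw [if_pos ha]
    exact StackProg.Runs.ite_true (by simp [ha]) h₂
  · rw [if_neg ha]
    exact StackProg.Runs.ite_false (by simp [ha]) (StackProg.runs_load id _ _)

theorem runs_parseSymbol_of_not_parsed (h : v.parsed = false) (a : Γ') (S : Stacks c) :
    StackProg.Runs parseSymbol ((some a, v), S) ((some a, v.digit (some a)), S) 2 :=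
  StackProg.Runs.ite_false h (StackProg.runs_load _ _ _)

/-- Read the whole input. -/
def parse : Prog c := drain .inp parseSymbol

theorem Runs.parse_cons {a : Γ'} {v' : Mem c} {r' : List Γ'} {n' : ℕ} {s : Mem c × Stacks c}
    {b : ℕ}
    (h : StackProg.Runs parseSymbol ((some a, v), conf l r n x y) ((some a, v'), conf l r' n' x y) 4)
    (hp : Runs parse (v', conf l r' n' x y) s b) :
    Runs parse (v, conf (a :: l) r n x y) s (5 + b) := by
  intro o
  obtain ⟨o', h'⟩ := hp (some a)
  refine ⟨o', (StackProg.Runs.drain_cons (k := Tape.inp) (f := fun v a => (a, v.2))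
      (c := fun v => v.1.isSome) (v := (o, v)) (a := a) (l := l) (b := 4) rfl rfl ?_ h').mono
      (by omega)⟩
  rw [update_inp]
  exact h

theorem runs_parse_of_parsed (h : v.parsed = true) :
    Runs parse (v, conf l r n x y)
      (v, conf [] (l.reverse ++ r) (n + l.count Γ'.comma) x y) (5 * l.length + 1) := by
  induction l generalizing r n with
  | nil => exact fun o => ⟨none, StackProg.runs_drain_nil (v := (o, v)) rfl rfl⟩
  | cons a l ih =>
    refine (Runs.parse_cons (runs_parseSymbol_of_parsed h a) ih).congr ?_ ?_
    · rw [List.reverse_cons, List.append_assoc, List.singleton_append, List.count_cons,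
        Nat.add_assoc, Nat.add_comm (ite _ _ _)]
      simp only [beq_iff_eq]
    · simp only [List.length_cons]
      omega

/-- Here `m` is the value of the digits read so far and `w` the weight of the next one. Cutting off
at `c + 1` is compatible with the sums and products formed, so finite memory suffices. The digits
and the first comma are discarded; the later commas, one per row, give the number of vertices. -/
theorem runs_parse (bs : List Bool) (h : v.parsed = false) (m w : ℕ) (hm : v.cnt = cap c m)
    (hw : v.wt = cap c w) :
    ∃ v' : Mem c, v'.ans = v.ans ∧ v'.cnt = cap c (m + w * ofBits bs) ∧
      Runs parse (v, conf (bs.map Γ'.bit ++ Γ'.comma :: l) r n x y)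
        (v', conf [] (l.reverse ++ r) (n + l.count Γ'.comma) x y)
        (5 * (bs.map Γ'.bit ++ Γ'.comma :: l).length + 1) := by
  induction bs generalizing v m w with
  | nil =>
    refine ⟨v.digit (some Γ'.comma), rfl, hm, ?_⟩
    refine (Runs.parse_cons ((runs_parseSymbol_of_not_parsed h Γ'.comma _).mono (by omega))
      (runs_parse_of_parsed rfl)).mono ?_
    simp only [List.map_nil, List.nil_append, List.length_cons]
    omega
  | cons b bs ih =>
    obtain ⟨v', h₁, h₂, h₃⟩ := ih (v := v.digit (some (Γ'.bit b))) h (m + b.toNat * w) (2 * w) (by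
        simp only [Mem.digit, hm, hw]
        cases b <;> simp [cap, Fin.ext_iff]
        omega) (by
        simp only [Mem.digit, hw, cap, Fin.ext_iff]
        omega)
    refine ⟨v', h₁, ?_, (Runs.parse_cons
      ((runs_parseSymbol_of_not_parsed h (Γ'.bit b) _).mono (by omega)) h₃).mono ?_⟩
    · rw [h₂, ofBits]
      congr 1
      ring
    · simp only [List.map_cons, List.cons_append, List.length_cons]
      omega

end parse

/-! ### Emptying the stacks -/

section clear

variable {l r : List Γ'} {n : ℕ} {x y : Fin (c + 1) → ℕ} {v : Mem c}

/-- Empty the input stack. -/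
def clearInp : Prog c := drain .inp skip

theorem runs_clearInp : Runs clearInp (v, conf l r n x y) (v, conf [] r n x y)
    (2 * l.length + 1) := by
  induction l with
  | nil => exact fun o => ⟨none, StackProg.runs_drain_nil (v := (o, v)) rfl rfl⟩
  | cons a l ih =>
    intro o
    obtain ⟨o', h'⟩ := ih (some a)
    refine ⟨o', (StackProg.Runs.drain_cons (k := Tape.inp) (f := fun v a => (a, v.2))
      (c := fun v => v.1.isSome) (v := (o, v)) (a := a) (l := l) (b := 1) rfl rfl ?_ h').mono
      (by simp only [List.length_cons]; omega)⟩
    rw [update_inp]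
    exact StackProg.runs_load _ _ _

theorem runs_loopNum_skip : Runs (loopNum skip) (v, conf l r n x y) (v, conf l r 0 x y)
    (2 * n + 1) := by
  induction n with
  | zero => exact runs_loopNum_zero
  | succ n ih => exact (Runs.loopNum_succ (runs_skip _) ih).mono (by omega)

theorem runs_loopNum_incCtr (k : Fin (c + 1)) :
    Runs (loopNum (incCtr k)) (v, conf l r n x y)
      (v, conf l r 0 (Function.update x k (x k + n)) y) (2 * n + 1) := by
  induction n generalizing x with
  | zero => exact runs_loopNum_zero.congr (by simp) (by omega)
  | succ n ih =>
    refine (Runs.loopNum_succ (runs_incCtr k) ih).congr ?_ (by omega)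
    rw [Function.update_self, Function.update_idem, Nat.add_assoc, Nat.add_comm 1]

theorem runs_loopCtr_skip (i : Fin (c + 1)) : Runs (loopCtr i skip) (v, conf l r n x y)
    (v, conf l r n (Function.update x i 0) y) (2 * x i + 1) := by
  obtain ⟨m, hm⟩ : ∃ m, x i = m := ⟨_, rfl⟩
  induction m generalizing x with
  | zero => exact (runs_loopCtr_zero hm).congr (by rw [update_of_eq hm]) (by omega)
  | succ m ih =>
    refine (Runs.loopCtr_succ hm (runs_skip _) (ih (Function.update_self ..))).congr ?_ ?_
    · rw [Function.update_idem]
    · rw [Function.update_self]; omega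

/-- Set the counters in a list to zero. -/
def clearCtrs : List (Fin (c + 1)) → Prog c
  | [] => skip
  | i :: l => .seq (loopCtr i skip) (clearCtrs l)

theorem runs_clearCtrs (t : List (Fin (c + 1))) {m : ℕ} (hx : ∀ i, x i ≤ m)
    (ht : ∀ i, i ∉ t → x i = 0) :
    Runs (clearCtrs t) (v, conf l r n x y) (v, conf l r n 0 y) (t.length * (2 * m + 1) + 1) := by
  induction t generalizing x with
  | nil => exact (runs_skip _).congr (by rw [funext fun i => ht i List.not_mem_nil]; rfl) (by omega)
  | cons i t ih =>
    refine ((runs_loopCtr_skip i).seq (ih (x := Function.update x i 0) ?_ ?_)).mono ?_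
    · intro j
      rw [Function.update_apply]
      split_ifs
      · omega
      · exact hx j
    · intro j hj
      by_cases hji : j = i
      · rw [hji, Function.update_self]
      · rw [Function.update_of_ne hji]
        exact ht j (by simp [hji, hj])
    · have := hx i
      rw [List.length_cons, Nat.add_one_mul t.length]
      omega

end clear

/-! ### The whole program -/

section main

variable {W : List Γ'} {n : ℕ} {A : ℕ → ℕ → Bool} {v : Mem c}

/-- Search with the number of vertices in the list that the memory holds. -/
noncomputable def dispatch (Q : GraphProperty) : List (Fin (c + 1)) → Prog c
  | [] => skip
  | k :: t => .ite (fun w => decide (w.2.cnt = k.castSucc))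
      (.seq (loopNum (incCtr k)) (search Q k k)) (dispatch Q t)

/-- There are `k` numbers below `n` at which the pattern of `A` has the property `Q`. -/
def Found (Q : GraphProperty) (A : ℕ → ℕ → Bool) (n : ℕ) (k : Fin (c + 1)) : Prop :=
  ∃ z : Fin (c + 1) → ℕ, (∀ j : Fin (c + 1), k ≤ j → z j = Function.update (0 : Fin (c + 1) → ℕ) k n j) ∧
    (∀ j < k.val, z (idx c j) < z (idx c (j + 1))) ∧
    Q _ (patternGraph k fun a b => A (z a) (z b))

theorem runs_search_start (Q : GraphProperty) (k : Fin (c + 1))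
    (hW : ∀ a b, a < n → b < n → W[a * (n + 1) + b]? = some (Γ'.bit (A a b))) :
    ∃ v' : Mem c, Runs (search Q k k) (v, headAt W 0 (Function.update 0 k n) 0)
        (v', headAt W 0 (Function.update 0 k n) 0) (searchTime k W.length n k) ∧
      (v'.ans = true ↔ v.ans = true ∨ Found Q A n k) :=
  runs_search Q hW k le_rfl (Function.update 0 k n)
    (Function.update_self ..) (fun j hj => Function.update_of_ne (by rintro rfl; omega) ..)
    (fun j h h' => by omega) v

/-- Each size has its own search program, chosen by the memory. If no size in the list fits, nothing
is searched and the vertex counter stays full; otherwise it has been moved to counter `k`. Only the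
bounds on `n'` and `x` matter for the cleanup. -/
theorem runs_dispatch (Q : GraphProperty)
    (hW : ∀ a b, a < n → b < n → W[a * (n + 1) + b]? = some (Γ'.bit (A a b)))
    (t : List (Fin (c + 1))) {b : ℕ} (hb : ∀ k ∈ t, searchTime k W.length n k ≤ b) :
    ∃ (v' : Mem c) (n' : ℕ) (x : Fin (c + 1) → ℕ), n' ≤ n ∧ (∀ i, x i ≤ n) ∧
      Runs (dispatch Q t) (v, conf W [] n 0 0) (v', conf W [] n' x 0)
        (2 * n + b + t.length + 2) ∧
      (v'.ans = true ↔ v.ans = true ∨ ∃ k ∈ t, v.cnt = k.castSucc ∧ Found Q A n k) := by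
  induction t with
  | nil => exact ⟨v, n, 0, le_rfl, fun _ => Nat.zero_le _, (runs_skip _).mono (by omega), by simp⟩
  | cons k t ih =>
    by_cases hk : v.cnt = k.castSucc
    · obtain ⟨v', hv, h⟩ := runs_search_start (v := v) Q k hW
      refine ⟨v', 0, Function.update 0 k n, Nat.zero_le _, fun i => ?_,
        (Runs.ite_true (t := fun w : Mem c => decide (w.cnt = k.castSucc)) (by simpa using hk)
        (((runs_loopNum_incCtr k).congr (b' := 2 * n + 1) (by simp [headAt]) le_rfl).seq hv)).mono ?_,
        h.trans (or_congr_right ⟨fun h => ⟨k, List.mem_cons_self, hk, h⟩, ?_⟩)⟩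
      · rw [Function.update_apply]
        split_ifs
        · exact le_rfl
        · exact Nat.zero_le _
      · have := hb k List.mem_cons_self
        simp only [List.length_cons]
        omega
      · rintro ⟨k', -, hk', h⟩
        rwa [Fin.castSucc_injective _ (hk.symm.trans hk')]
    · obtain ⟨v', n', x, hn, hx, hv, h⟩ := ih fun k' hk' => hb k' (List.mem_cons_of_mem _ hk')
      refine ⟨v', n', x, hn, hx, (Runs.ite_false
        (t := fun w : Mem c => decide (w.cnt = k.castSucc)) (by simpa using hk) hv).mono ?_, ?_⟩
      · simp only [List.length_cons]
        omega
      · rw [h]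
        simp [hk]

/-- The whole program. -/
noncomputable def main (c : ℕ) (Q : GraphProperty) : Prog c :=
  .seq parse (.seq rewind (.seq (dispatch Q (List.finRange (c + 1)))
    (.seq clearInp (.seq (loopNum skip) (clearCtrs (List.finRange (c + 1)))))))

/-- The memory at the start. -/
def Mem.init (c : ℕ) : Mem c := ⟨cap c 0, cap c 1, false, fun _ _ => false, false⟩

theorem conf_nil : conf [] [] 0 (0 : Fin (c + 1) → ℕ) 0 = fun _ => [] := by
  funext k
  cases k <;> rfl

theorem conf_input (l : List Γ') :
    conf l [] 0 (0 : Fin (c + 1) → ℕ) 0 = Function.update (fun _ => []) .inp l := by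
  rw [← conf_nil, update_inp]

theorem runs_main (Q : GraphProperty) (m : ℕ)
    (hW : ∀ a b, a < n → b < n → W[a * (n + 1) + b]? = some (Γ'.bit (A a b)))
    (hn : W.count Γ'.comma = n) {b : ℕ}
    (hb : ∀ k : Fin (c + 1), searchTime k W.length n k ≤ b) :
    ∃ v' : Mem c, (v'.ans = true ↔ ∃ k : Fin (c + 1), k.val = m ∧ Found Q A n k) ∧
      Runs (main c Q) (Mem.init c, conf ((encodeNat m).map Γ'.bit ++ Γ'.comma :: W) [] 0 0 0)
        (v', conf [] [] 0 0 0)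
        (5 * ((encodeNat m).map Γ'.bit ++ Γ'.comma :: W).length + 4 * W.length + 4 * n + b + c + 9 +
          (c + 1) * (2 * n + 1)) := by
  obtain ⟨v₁, hans, hcnt, h₁⟩ := runs_parse (c := c) (l := W) (r := []) (n := 0) (x := 0) (y := 0)
    (v := Mem.init c) (encodeNat m) rfl 0 1 rfl rfl
  rw [ofBits_encodeNat, Nat.zero_add, Nat.one_mul] at hcnt
  rw [Nat.zero_add, hn, List.append_nil] at h₁
  obtain ⟨v₂, n', x, hn', hx, h₂, hans₂⟩ := runs_dispatch (v := v₁) Q hW (List.finRange (c + 1))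
    fun k _ => hb k
  have h₃ := h₁.seq ((runs_rewind.congr (s'' := (v₁, conf W [] n 0 0)) (by simp) le_rfl).seq
    (h₂.seq (runs_clearInp.seq (runs_loopNum_skip.seq
      (runs_clearCtrs (List.finRange (c + 1)) hx (fun i hi => (hi (List.mem_finRange i)).elim))))))
  refine ⟨v₂, ?_, h₃.mono ?_⟩
  · rw [hans₂, hans]
    simp only [Mem.init, Bool.false_eq_true, false_or, List.mem_finRange, true_and, hcnt]
    refine exists_congr fun k => and_congr_left' ?_
    -- A number `m > c` is stored as `c + 1`, which differs from every `k.castSucc`; so no search is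
    -- started and the answer stays negative.
    simp only [cap, Fin.ext_iff, Fin.val_castSucc]
    have := k.2
    omega
  · rw [List.length_finRange, List.length_reverse]
    omega

end main

/-! ### The input word and the correctness of the search -/

theorem getElem?_flatten_of_length_eq {α : Type*} {m : ℕ} (L : List (List α))
    (hL : ∀ l ∈ L, l.length = m) {a b : ℕ} (hb : b < m) :
    L.flatten[a * m + b]? = L[a]?.bind fun l => l[b]? := by
  induction L generalizing a with
  | nil => simp
  | cons l L ih =>
    have hl := hL l List.mem_cons_self
    cases a with
    | zero =>
      rw [List.flatten_cons, Nat.zero_mul, Nat.zero_add, List.getElem?_append_left (by omega)]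
      simp
    | succ a =>
      rw [List.flatten_cons, List.getElem?_append_right (by rw [hl, Nat.add_one_mul a]; omega),
        List.getElem?_cons_succ, ← ih fun l hl => hL l (List.mem_cons_of_mem _ hl)]
      congr 1
      rw [hl, Nat.add_one_mul a]
      omega

open Classical in
/-- The adjacency matrix of a graph as a function on all pairs of numbers. -/
noncomputable def adjacency {n : ℕ} (G : SimpleGraph (Fin n)) (a b : ℕ) : Bool :=
  decide (∃ (ha : a < n) (hb : b < n), G.Adj ⟨a, ha⟩ ⟨b, hb⟩)

theorem adjacency_val {n : ℕ} (G : SimpleGraph (Fin n)) (a b : Fin n) :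
    adjacency G a b = true ↔ G.Adj a b := by
  simp [adjacency]

/-- The rows of the adjacency matrix, one after the other. -/
noncomputable def matrixWord {n : ℕ} (G : SimpleGraph (Fin n)) : List Γ' :=
  ((List.finRange n).map (InducedSubgraphProblem.encodeRow G)).flatten

theorem length_matrixWord {n : ℕ} (G : SimpleGraph (Fin n)) :
    (matrixWord G).length = n * (n + 1) := by
  simp [matrixWord, InducedSubgraphProblem.length_encodeRow, Function.comp_def]

theorem count_comma_matrixWord {n : ℕ} (G : SimpleGraph (Fin n)) :
    (matrixWord G).count Γ'.comma = n := by
  have h : ∀ i, (InducedSubgraphProblem.encodeRow G i).count Γ'.comma = 1 := by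
    intro i
    simp [InducedSubgraphProblem.encodeRow, List.count_append, List.count_eq_zero]
  simp [matrixWord, List.count_flatten, Function.comp_def, h]

theorem getElem?_matrixWord {n : ℕ} (G : SimpleGraph (Fin n)) (a b : ℕ) (ha : a < n) (hb : b < n) :
    (matrixWord G)[a * (n + 1) + b]? = some (Γ'.bit (adjacency G a b)) := by
  rw [matrixWord, getElem?_flatten_of_length_eq _ _ (by omega)]
  · classical
    have : adjacency G a b = decide (G.Adj ⟨a, ha⟩ ⟨b, hb⟩) := by simp [adjacency, ha, hb]
    simp [ha, hb, InducedSubgraphProblem.encodeRow, List.getElem?_append, this]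
  · intro l hl
    obtain ⟨i, -, rfl⟩ := List.mem_map.1 hl
    exact InducedSubgraphProblem.length_encodeRow G i

theorem patternGraph_eq_comap {n : ℕ} (G : SimpleGraph (Fin n)) {k : Fin (c + 1)}
    (f : {i : Fin (c + 1) // i < k} ↪ Fin n) (z : Fin (c + 1) → ℕ) (hz : ∀ i, z i.1 = f i) :
    patternGraph k (fun a b => adjacency G (z a) (z b)) = G.comap f := by
  ext i j
  simp only [patternGraph, SimpleGraph.fromRel_adj, hz, adjacency_val, SimpleGraph.comap_adj]
  constructor
  · rintro ⟨-, ⟨-, h⟩ | ⟨-, h⟩⟩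
    · exact h
    · exact h.symm
  · intro h
    have hne : i ≠ j := fun hij => h.ne (congrArg f hij)
    rcases lt_or_gt_of_ne hne with hlt | hlt
    · exact ⟨hne, .inl ⟨hlt, h⟩⟩
    · exact ⟨hne, .inr ⟨hlt, h.symm⟩⟩

/-- The graph that an embedding of vertices induces is isomorphic to the induced subgraph on its
range. -/
noncomputable def comapIsoInduceRange {V W : Type} (G : SimpleGraph W) (f : V ↪ W) :
    G.comap f ≃g G.induce (Set.range f) :=
  ⟨Equiv.ofInjective f f.injective, Iff.rfl⟩

/-- A set of `k` vertices is the same as its increasing enumeration. The pattern of the enumeration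
is isomorphic to the induced subgraph, so the invariance of `Q` under isomorphism transfers the
property. -/
theorem found_iff {Q : GraphProperty} (hQ : GraphProperty.IsoInvariant Q) {n : ℕ}
    (G : SimpleGraph (Fin n)) (k : Fin (c + 1)) :
    Found Q (adjacency G) n k ↔ ∃ S : Finset (Fin n), S.card = k ∧
      Q (S : Set (Fin n)) (G.induce (S : Set (Fin n))) := by
  have hkc : k.val ≤ c := Nat.le_of_lt_succ k.2
  constructor
  · rintro ⟨z, hz, hlt, h⟩
    have hn : ∀ i : Fin (c + 1), i < k → z i < n := by
      intro i hi
      have h1 := lt_of_forall_lt_succ (i := 0) (fun j _ hj => hlt j hj) (Nat.zero_le i) hi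
      rwa [idx_val, idx_val, hz k le_rfl, Function.update_self] at h1
    have hmono : ∀ i j : Fin (c + 1), i < j → j < k → z i < z j := by
      intro i j hij hj
      have h1 := lt_of_forall_lt_succ (i := 0) (k := j)
        (fun m _ hm => hlt m (lt_trans hm hj)) (Nat.zero_le i) hij
      rwa [idx_val, idx_val] at h1
    let f : {i : Fin (c + 1) // i < k} ↪ Fin n := ⟨fun i => ⟨z i, hn i i.2⟩, by
      intro i j hij
      have hij' : z i = z j := congrArg Fin.val hij
      rcases lt_trichotomy i j with h | h | h
      · exact absurd hij' (hmono i j h j.2).ne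
      · exact h
      · exact absurd hij' (hmono j i h i.2).ne'⟩
    refine ⟨Finset.univ.map f, ?_, ?_⟩
    · rw [Finset.card_map, Finset.card_univ, Fintype.card_subtype]
      have : (Finset.univ.filter fun i : Fin (c + 1) => i < k) = Finset.Iio k := by ext; simp
      rw [this, Fin.card_Iio]
    · have hS : ((Finset.univ.map f : Finset (Fin n)) : Set (Fin n)) = Set.range f := by simp
      rw [hS, ← hQ (comapIsoInduceRange G f), ← patternGraph_eq_comap G f z fun _ => rfl]
      exact h
  · rintro ⟨S, hS, h⟩
    let e := S.orderEmbOfFin hS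
    let f : {i : Fin (c + 1) // i < k} ↪ Fin n := ⟨fun i => e ⟨i.1, i.2⟩, by
      intro i j hij
      have := congrArg Fin.val (e.injective hij)
      exact Subtype.ext (Fin.ext this)⟩
    let z : Fin (c + 1) → ℕ := fun i =>
      if h : i < k then (e ⟨i, h⟩).val else Function.update (0 : Fin (c + 1) → ℕ) k n i
    have hz : ∀ (i : Fin (c + 1)) (h : i < k), z i = (e ⟨i, h⟩).val := fun i h => dif_pos h
    refine ⟨z, fun j hj => dif_neg (Fin.not_lt.2 hj), fun j hj => ?_, ?_⟩
    · have hj' : (idx c j).val = j := val_idx (by omega)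
      have hj1 : (idx c (j + 1)).val = j + 1 := val_idx (by omega)
      rw [hz _ (by rw [Fin.lt_def]; omega)]
      rcases Nat.lt_or_ge (j + 1) k with h1 | h1
      · rw [hz _ (by rw [Fin.lt_def]; omega)]
        apply Fin.lt_def.1
        rw [OrderEmbedding.lt_iff_lt, Fin.lt_def]
        simp only
        omega
      -- After the last vertex comes the sentinel `z k = n`, so the last inequality only says that
      -- this vertex is below `n`.
      · have : idx c (j + 1) = k := Fin.ext (by omega)
        have hk : z k = n := (dif_neg (lt_irrefl k)).trans (Function.update_self ..)
        rw [this, hk]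
        exact Fin.is_lt _
    · rw [patternGraph_eq_comap G f z fun i => hz i i.2, hQ (comapIsoInduceRange G f)]
      have hf : Set.range f = S := by
        rw [← Finset.range_orderEmbOfFin S hS]
        ext a
        constructor
        · rintro ⟨i, rfl⟩
          exact ⟨_, rfl⟩
        · rintro ⟨i, rfl⟩
          exact ⟨⟨⟨i, i.2.trans k.2⟩, i.2⟩, rfl⟩
      rw [hf]
      exact h

open Polynomial in
/-- A polynomial that bounds the number of steps of the search. -/
noncomputable def searchPoly (k : Fin (c + 1)) : ℕ → Polynomial ℕ
  | 0 => C (pairsBelow k).length * (6 * (X * (X + 1)) + 8 * X + 2 * X + 8) + 2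
  | i + 1 => 5 * X + 2 + (X * (searchPoly k i + 1) + 1)

theorem searchTime_le (k : Fin (c + 1)) {w n L : ℕ} (hw : w ≤ L) (hn : n ≤ L) (i : ℕ) :
    searchTime k w n i ≤ (searchPoly k i).eval L := by
  induction i with
  | zero =>
    simp only [searchTime, searchPoly, readTime, Polynomial.eval_add, Polynomial.eval_mul,
      Polynomial.eval_C, Polynomial.eval_X, Polynomial.eval_one, Polynomial.eval_ofNat]
    gcongr
  | succ i ih =>
    simp only [searchTime, searchPoly, Polynomial.eval_add, Polynomial.eval_mul,
      Polynomial.eval_X, Polynomial.eval_one, Polynomial.eval_ofNat]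
    gcongr

end SubsetSearch

/-! ### Polynomial time from a bound on the size of solutions -/

namespace InducedSubgraphProblem

open Polynomial in
/-- If all induced subgraphs with the property `Q` of graphs with the property `PG` have at most
`c` vertices, then an exhaustive search takes polynomial time. -/
theorem solvableInPolyTime_of_card_le {PG Q : GraphProperty} (hQ : GraphProperty.IsoInvariant Q)
    (c : ℕ) (hc : ∀ (x : Instance PG) (S : Finset (Fin x.n)),
      Q (S : Set (Fin x.n)) (x.graph.induce (S : Set (Fin x.n))) → S.card ≤ c) :
    SolvableInPolyTime PG Q := by
  refine StackProg.computableInPolyTime _ _ (SubsetSearch.Tape.inp (c := c))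
    (none, SubsetSearch.Mem.init c) (fun w => w.2.ans) (SubsetSearch.main c Q)
    -- The coefficient is `13 = 5 + 4 + 4`: the bound in `runs_main` has 5 times the input length, 4
    -- times the length of the matrix word and `4 * n`, and the last two quantities are at most the
    -- input length. The sum over `k` dominates the search for whichever size occurs.
    (13 * X + (∑ k : Fin (c + 1), SubsetSearch.searchPoly k k) + C (c + 9) +
      C (c + 1) * (2 * X + 1)) fun x => ?_
  have hlen : (encodeInstance x).length = (encodeNat x.k).length + 1 + x.n * (x.n + 1) := by
    rw [encodeInstance, List.length_append, List.length_cons, List.length_map]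
    have := SubsetSearch.length_matrixWord x.graph
    unfold SubsetSearch.matrixWord at this
    omega
  have hn : x.n ≤ (encodeInstance x).length := by
    rw [hlen]
    nlinarith
  have hw : (SubsetSearch.matrixWord x.graph).length ≤ (encodeInstance x).length := by
    rw [hlen, SubsetSearch.length_matrixWord]
    omega
  obtain ⟨v, hv, h⟩ := SubsetSearch.runs_main (c := c) Q x.k
    (SubsetSearch.getElem?_matrixWord x.graph) (SubsetSearch.count_comma_matrixWord x.graph)
    (b := (∑ k : Fin (c + 1), SubsetSearch.searchPoly k k).eval (encodeInstance x).length)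
    fun k => by
      refine (SubsetSearch.searchTime_le k hw hn k).trans ?_
      rw [Polynomial.eval_finsetSum]
      exact Finset.single_le_sum (f := fun k : Fin (c + 1) =>
        (SubsetSearch.searchPoly k k).eval (encodeInstance x).length)
        (fun _ _ => Nat.zero_le _) (Finset.mem_univ k)
  obtain ⟨o, h⟩ := h none
  rw [SubsetSearch.conf_input, SubsetSearch.conf_nil] at h
  refine ⟨(o, v), ?_, h.mono ?_⟩
  · rw [Bool.eq_iff_iff, hv, @decide_eq_true_iff _ (Classical.propDecidable _)]
    simp only [SubsetSearch.found_iff hQ]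
    constructor
    · rintro ⟨k, hk, S, hS, hS'⟩
      exact ⟨S, hS.trans hk, hS'⟩
    · rintro ⟨S, hS, hS'⟩
      -- The bound on solutions makes `x.k` one of the sizes that the program searches.
      have := hc x S hS'
      exact ⟨⟨x.k, by omega⟩, rfl, S, hS, hS'⟩
  · change 5 * (encodeInstance x).length + _ + _ + _ + _ + _ + _ ≤ _
    simp only [Polynomial.eval_add, Polynomial.eval_mul, Polynomial.eval_C, Polynomial.eval_X,
      Polynomial.eval_one, Polynomial.eval_ofNat]
    have := Nat.mul_le_mul_left (c + 1) (Nat.add_le_add_right (Nat.mul_le_mul_left 2 hn) 1)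
    omega

end InducedSubgraphProblem

theorem mainTheorem6 (Q : GraphProperty)
    (hQ : Q = forest ∨ Q = planar ∨ Q = bipartite ∨ Q = triangleFree) :
    InducedSubgraphProblem.SolvableInPolyTime coBipartite Q ∧
      InducedSubgraphProblem.SolvableInPolyTime Q coBipartite := by
  have h : GraphProperty.ExcludesFive Q := by
    rcases hQ with rfl | rfl | rfl | rfl
    · exact GraphProperty.excludesFive_forest
    · exact GraphProperty.excludesFive_planar
    · exact GraphProperty.excludesFive_bipartite
    · exact GraphProperty.excludesFive_triangleFree
  -- In the first problem the induced subgraph inherits co-bipartiteness from the input graph, in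
  -- the second it inherits `Q`; either way it has both.
  constructor
  · refine InducedSubgraphProblem.solvableInPolyTime_of_card_le h.isoInvariant 8 fun x S hS => ?_
    simpa using h.card_le_eight hS (GraphProperty.coBipartite_induce x.graph_mem _)
  · refine InducedSubgraphProblem.solvableInPolyTime_of_card_le
      GraphProperty.isoInvariant_coBipartite 8 fun x S hS => ?_
    simpa using h.card_le_eight (h.induce x.graph_mem _) hS
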